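/- **Setting.** Let $\Omega=[0,2\pi]^2$. Let $\mathcal V$ be the set of $\mathbb R^2$-valued $\Omega$-periodic divergence-free trigonometric polynomials with zero average over $\Omega$, $H$ the closure of $\mathcal V$ in $L^2(\Omega)^2$ (inner product $\langle\cdot,\cdot\rangle$), and $V$ the closure of $\mathcal V$ in $H^1(\Omega)^2$, with inner product $\langle\!\langle u,v\rangle\!\rangle=\sum_{j=1}^2\int_\Omega \partial_j u\cdot\partial_j v\,dx$ and norm $\|u\|=\langle\!\langle u,u\rangle\!\rangle^{1/2}$. For $u,v\in V$ let $Au,\,B(u,v)\in V'$ be given by $\langle Au,\varphi\rangle_{V',V}=\langle\!\langle u,\varphi\rangle\!\rangle$ and $\langle B(u,v),\varphi\rangle_{V',V}=\int_\Omega((u\cdot\nabla)v)\cdot\varphi\,dx$ for $\varphi\in V$, let $B_{\rm s}(u,v)=B(u,v)+B(v,u)$, and regard $H\subset V'$ through $\langle\cdot,\cdot\rangle$. *Comparison.* For sequences of positive numbers, $\xi_n\succ\eta_n$ means $\xi_n/\eta_n\to\infty$; $\xi_n\sim\eta_n$ means $\xi_n/\eta_n\to\lambda$ for some $\lambda\in(0,\infty)$;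 $\xi_n\succsim\eta_n$ means $\xi_n\succ\eta_n$ or $\xi_n\sim\eta_n$. A set of such sequences is *totally comparable* if any two members satisfy $\xi\sim\eta$, $\xi\succ\eta$ or $\eta\succ\xi$. *Expansions.* A sequence $(v_n)$ in $V$ has a *relaxed expansion* $v_n\approx v+\sum_{k\in\mathcal N}\Gamma_{k,n}w_k$ in $V$, where $\mathcal N=\emptyset$, $\mathcal N=\{1,\dots,K\}$ or $\mathcal N=\mathbb N=\{1,2,\dots\}$, if $v_n=v$ for all $n$ in the case $\mathcal N=\emptyset$, and otherwise $v,w_k\in V$, $\Gamma_{k,n}>0$, $\Gamma_{1,n}\to0$, $\Gamma_{k+1,n}/\Gamma_{k,n}\to0$ whenever $k,k+1\in\mathcal N$, and there are $w_n^{(k)}\in V$ with $w^{(k)}_n\to w_k$ in $V$ and $v_n=v+\sum_{j=1}^{k-1}\Gamma_{j,n}w_j+\Gamma_{k,n}w_n^{(k)}$ for all $n$ and all $k\in\mathcal N$; if $\mathcal N=\{1,\dots,K\}$ it is also required that $w_n^{(K)}=w_K\neq0$ for all $n$. The expansion is *unitary* if moreover $\|w_k\|=1$ for all $k\in\mathcal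 N$. It is *degenerate* if $\mathcal N=\mathbb N$ and either $w_k=0$ for all $k\ge1$, or for some $N\ge1$ one has $\|w_k\|=1$ for $1\le k\le N$ and $w_k=0$ for $k>N$. **Hypotheses.** Let $g\in H\setminus\{0\}$, $\alpha_n>0$ with $\alpha_n\to\infty$, and let $v_n\in V$ satisfy $Av_n+\alpha_nB(v_n,v_n)=g$ in $V'$ for all $n$. Suppose $(v_n)$ has a unitary or degenerate expansion $v_n\approx v+\sum_{k\in\mathcal N}\Gamma_{k,n}w_k$ in $V$, and that the set $\mathcal S$ of the sequences $(\alpha_n)$, $(1)$, $(\Gamma_{k,n})$, $(\alpha_n\Gamma_{k,n})$, $(\alpha_n\Gamma_{j,n}\Gamma_{k,n})$ with $j,k\in\mathcal N$, $j\le k$, is totally comparable. **Theorem 4.6.** Assume $v=0$. Then $\alpha_n\Gamma_{1,n}^2\succsim1$ and $w_2$ exists, that is, $2\in\mathcal N$. (i) Case $\alpha_n\Gamma_{1,n}^2\succ1$. Then $B(w_1,w_1)=0$ and $\alpha_n\Gamma_{1,n}\Gamma_{2,n}\succsim1$. In addition, - (1) if $\alpha_n\Gamma_{1,n}\Gamma_{2,n}\succ1$,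 then $B_{\rm s}(w_1,w_2)=0$; - (2) if $\alpha_n\Gamma_{1,n}\Gamma_{2,n}\sim1$, then $\mu B_{\rm s}(w_1,w_2)=g$ for some $\mu>0$, and $\langle g,w_1\rangle=0$. (ii) Case $\alpha_n\Gamma_{1,n}^2\sim1$. Let $\mu_*=\lim_{n\to\infty}\alpha_n\Gamma_{1,n}^2\in(0,\infty)$. Then $\mu_*B(w_1,w_1)=g$. Put $\chi_n=1-\alpha_n\Gamma_{1,n}^2/\mu_*$ and assume further (Assumption 4.5) that either $\chi_n=0$ for all $n$; or $\chi_n>0$ for all $n$ and $\mathcal S\cup\{(\chi_n)\}$ is totally comparable; or $\chi_n<0$ for all $n$ and $\mathcal S\cup\{(-\chi_n)\}$ is totally comparable. Then the following hold. - (1) Case $1\succ\alpha_n\Gamma_{2,n}$. Then $\chi_n=0$ for all $n$, or $\Gamma_{1,n}\succ|\chi_n|$. In this case $\mathcal N=\mathbb N$, $w_k=0$ for all $k\ge1$, and the expansion is the degenerate expansion $v_n\approx0+\sum_{k=1}^\infty\Gamma_{k,n}\cdot0$ in $V$. - (2) Case $\alpha_n\Gamma_{2,n}\sim1$. Then $\chi_n=0$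 for all $n$, or $\Gamma_{1,n}\succsim|\chi_n|$. - (a) If $\Gamma_{1,n}\sim|\chi_n|$, then there are $\mu_1,\mu_2\in\mathbb R$ with $\mu_1\mu_2>0$, $\mu_1Aw_1+\mu_2B_{\rm s}(w_1,w_2)=g$ and $\mu_*\mu_1\|w_1\|^2=\mu_2\langle g,w_2\rangle$. - (b) If $\chi_n=0$ for all $n$, or $\Gamma_{1,n}\succ|\chi_n|$, then there is $\mu_2>0$ with $Aw_1+\mu_2B_{\rm s}(w_1,w_2)=0$ and $\mu_*\|w_1\|^2=\mu_2\langle g,w_2\rangle$. - (3) Case $\alpha_n\Gamma_{2,n}\succ1$. Then $\chi_n=0$ for all $n$, or $\alpha_n\Gamma_{1,n}\Gamma_{2,n}\succsim|\chi_n|$. - (a) If $\alpha_n\Gamma_{1,n}\Gamma_{2,n}\sim|\chi_n|$, then $\mu_2B_{\rm s}(w_1,w_2)=g$ for some $\mu_2\neq0$, and $\langle g,w_2\rangle=\langle B(w_2,w_2),w_1\rangle_{V',V}=0$. - (b) If $\chi_n=0$ for all $n$, or $\alpha_n\Gamma_{1,n}\Gamma_{2,n}\succ|\chi_n|$, then $B_{\rm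 s}(w_1,w_2)=0$ and $\langle g,w_2\rangle=\langle B(w_2,w_2),w_1\rangle_{V',V}=0$. -/

import Mathlib

open MeasureTheory Filter Topology

namespace PeriodicNSE

noncomputable section

/-! ### Two-dimensional periodic vector fields on the cell `[0, 2π]²` -/

/-- The plane of the space variable. -/
abbrev Plane : Type := Fin 2 → ℝ

/-- The values of a velocity field, with the Euclidean inner product. -/
abbrev Vec : Type := EuclideanSpace ℝ (Fin 2)

/-- The periodicity cell `Ω = [0, 2π]²` (the first eigenvalue of the Stokes operator is `1`). -/
def cell : Set Plane := Set.Icc 0 (fun _ => 2 * Real.pi)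

/-- Lebesgue measure on the periodicity cell. -/
def cellMeasure : Measure Plane := volume.restrict cell

/-- The space `L²(Ω)²`. -/
abbrev L2 : Type := Lp Vec 2 cellMeasure

/-- The exponential `x ↦ exp (i k · x)`. -/
def expo (k : Fin 2 → ℤ) (x : Plane) : ℂ :=
  Complex.exp (Complex.I * ∑ j, (k j : ℂ) * (x j : ℂ))

/-- An `ℝ²`-valued trigonometric polynomial with the periods of the cell. -/
def IsTrigPoly (u : Plane → Vec) : Prop :=
  ∃ c : (Fin 2 → ℤ) →₀ (Fin 2 → ℂ), ∀ (x : Plane) (i : Fin 2),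
    ((u x i : ℝ) : ℂ) = c.sum fun k a => a i * expo k x

/-- The partial derivative `∂u/∂x_j` of a vector field. -/
def pderiv (j : Fin 2) (u : Plane → Vec) (x : Plane) : Vec :=
  fderiv ℝ u x (Pi.single j 1)

/-- The set `𝒱` of `ℝ²`-valued periodic divergence-free trigonometric polynomials
with zero average over the cell. -/
structure IsTestField (u : Plane → Vec) : Prop where
  trig : IsTrigPoly u
  div_free : ∀ x, ∑ j, pderiv j u x j = 0
  mean_zero : ∫ x in cell, u x = 0

/-! #### Trigonometric polynomials: linearity, smoothness, Parseval's identity -/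

lemma IsTrigPoly.zero : IsTrigPoly 0 := ⟨0, by simp⟩

lemma IsTrigPoly.add {u v : Plane → Vec} (hu : IsTrigPoly u) (hv : IsTrigPoly v) :
    IsTrigPoly (u + v) := by
  obtain ⟨c, hc⟩ := hu
  obtain ⟨d, hd⟩ := hv
  refine ⟨c + d, fun x i => ?_⟩
  rw [Finsupp.sum_add_index' (by simp) (by intros; simp [add_mul])]
  simp [← hc, ← hd]

lemma IsTrigPoly.smul {u : Plane → Vec} (a : ℝ) (hu : IsTrigPoly u) : IsTrigPoly (a • u) := by
  obtain ⟨c, hc⟩ := hu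
  refine ⟨(a : ℂ) • c, fun x i => ?_⟩
  rw [Finsupp.sum_smul_index' (by simp)]
  simp only [Pi.smul_apply, PiLp.smul_apply, smul_eq_mul, Complex.ofReal_mul, hc,
    Finsupp.sum, Finset.mul_sum, mul_assoc]

lemma hasFDerivAt_expo (k : Fin 2 → ℤ) (x : Plane) :
    HasFDerivAt (expo k) (expo k x • (Complex.I • ∑ j, (k j : ℂ) •
      (Complex.ofRealCLM.comp (ContinuousLinearMap.proj (R := ℝ) (φ := fun _ : Fin 2 => ℝ) j)))) x := by
  have h : ∀ j : Fin 2, HasFDerivAt (fun y : Plane => (y j : ℂ))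
      (Complex.ofRealCLM.comp (ContinuousLinearMap.proj (R := ℝ) (φ := fun _ : Fin 2 => ℝ) j)) x :=
    fun j => (Complex.ofRealCLM.comp
      (ContinuousLinearMap.proj (R := ℝ) (φ := fun _ : Fin 2 => ℝ) j)).hasFDerivAt
  exact ((HasFDerivAt.fun_sum fun j _ => (h j).const_mul (k j : ℂ)).const_mul Complex.I).cexp

lemma continuous_expo (k : Fin 2 → ℤ) : Continuous (expo k) := by
  unfold expo; fun_prop

lemma IsTrigPoly.differentiable {u : Plane → Vec} (hu : IsTrigPoly u) : Differentiable ℝ u := by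
  obtain ⟨c, hc⟩ := hu
  rw [differentiable_euclidean]
  intro i
  have h : (fun x => u x i) = fun x => Complex.reCLM (c.sum fun k a => a i * expo k x) := by
    funext x; rw [← hc]; simp
  rw [h]
  refine Complex.reCLM.differentiable.comp ?_
  unfold Finsupp.sum
  refine Differentiable.fun_sum fun k _ => ?_
  exact Differentiable.const_mul (fun x => (hasFDerivAt_expo k x).differentiableAt) _

lemma IsTrigPoly.pderiv_eq {u : Plane → Vec} {c : (Fin 2 → ℤ) →₀ (Fin 2 → ℂ)}
    (hc : ∀ (x : Plane) (i : Fin 2), ((u x i : ℝ) : ℂ) = c.sum fun k a => a i * expo k x)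
    (j : Fin 2) (x : Plane) (i : Fin 2) :
    ((pderiv j u x i : ℝ) : ℂ) =
      ∑ k ∈ c.support, (Complex.I * (k j : ℂ) * c k i) * expo k x := by
  have hd := (IsTrigPoly.differentiable ⟨c, hc⟩ x).hasFDerivAt
  have h1 := Complex.ofRealCLM.hasFDerivAt.comp x
    ((EuclideanSpace.proj (𝕜 := ℝ) i).hasFDerivAt.comp x hd)
  have h2 : HasFDerivAt (fun x : Plane => ((u x i : ℝ) : ℂ)) _ x := h1
  have h3 := HasFDerivAt.fun_sum (u := c.support) (x := x)
    fun k _ => (hasFDerivAt_expo k x).const_mul (c k i)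
  have h4 : (fun x : Plane => ((u x i : ℝ) : ℂ)) =
      fun x => ∑ k ∈ c.support, c k i * expo k x := by
    funext y; rw [hc]; rfl
  rw [h4] at h2
  have h5 := congrArg (fun T => T (Pi.single j 1)) (h2.unique h3)
  have h6 : ((pderiv j u x i : ℝ) : ℂ) = _ := h5
  rw [h6]
  simp only [sum_apply, smul_apply, smul_eq_mul,
    ContinuousLinearMap.comp_apply, ContinuousLinearMap.proj_apply, Complex.ofRealCLM_apply]
  refine Finset.sum_congr rfl fun k _ => ?_
  have h7 : ∑ l : Fin 2, (k l : ℂ) * (((Pi.single j 1 : Plane) l : ℝ) : ℂ) = k j := by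
    rw [Finset.sum_eq_single j] <;> simp +contextual
  rw [h7]; ring

lemma pderiv_add {u v : Plane → Vec} (hu : IsTrigPoly u) (hv : IsTrigPoly v) (j : Fin 2)
    (x : Plane) : pderiv j (u + v) x = pderiv j u x + pderiv j v x := by
  simp [pderiv, fderiv_add (hu.differentiable x) (hv.differentiable x)]

lemma pderiv_smul {u : Plane → Vec} (hu : IsTrigPoly u) (a : ℝ) (j : Fin 2)
    (x : Plane) : pderiv j (a • u) x = a • pderiv j u x := by
  simp [pderiv, fderiv_const_smul (hu.differentiable x)]

lemma IsTrigPoly.integrableOn {u : Plane → Vec} (hu : IsTrigPoly u) : IntegrableOn u cell :=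
  hu.differentiable.continuous.continuousOn.integrableOn_compact isCompact_Icc

lemma IsTestField.zero : IsTestField 0 where
  trig := .zero
  div_free x := by simp [pderiv]
  mean_zero := by simp

lemma IsTestField.add {u v : Plane → Vec} (hu : IsTestField u) (hv : IsTestField v) :
    IsTestField (u + v) where
  trig := hu.trig.add hv.trig
  div_free x := by
    simp only [pderiv_add hu.trig hv.trig, PiLp.add_apply, Finset.sum_add_distrib,
      hu.div_free, hv.div_free, add_zero]
  mean_zero := by
    simp only [Pi.add_apply]
    rw [integral_add hu.trig.integrableOn hv.trig.integrableOn, hu.mean_zero, hv.mean_zero,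
      add_zero]

lemma IsTestField.smul {u : Plane → Vec} (a : ℝ) (hu : IsTestField u) : IsTestField (a • u) where
  trig := hu.trig.smul a
  div_free x := by
    simp only [pderiv_smul hu.trig, PiLp.smul_apply, smul_eq_mul, ← Finset.mul_sum,
      hu.div_free, mul_zero]
  mean_zero := by
    simp only [Pi.smul_apply]
    rw [integral_smul, hu.mean_zero, smul_zero]

lemma integral_expo (k : Fin 2 → ℤ) :
    ∫ x in cell, expo k x = if k = 0 then ((2 * Real.pi) ^ 2 : ℂ) else 0 := by
  have h1 : cellMeasure =
      Measure.pi (fun _ : Fin 2 => (volume : Measure ℝ).restrict (Set.Icc 0 (2 * Real.pi))) := by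
    rw [← Measure.restrict_pi_pi, Set.pi_univ_Icc]; rfl
  have h2 : ∀ x, expo k x = ∏ j, Complex.exp (Complex.I * (k j : ℂ) * (x j : ℂ)) := by
    intro x
    rw [← Complex.exp_sum, expo, Finset.mul_sum]
    simp only [mul_assoc]
  have h3 : ∀ m : ℤ, ∫ t in Set.Icc (0 : ℝ) (2 * Real.pi),
      Complex.exp (Complex.I * (m : ℂ) * (t : ℂ)) =
        if m = 0 then (2 * Real.pi : ℂ) else 0 := by
    intro m
    rw [integral_Icc_eq_integral_Ioc, ← intervalIntegral.integral_of_le (by positivity)]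
    split_ifs with hm
    · subst hm; simp
    · rw [integral_exp_mul_complex (by simp [hm])]
      have : Complex.exp (Complex.I * (m : ℂ) * ((2 * Real.pi : ℝ) : ℂ)) = 1 := by
        rw [← Complex.exp_int_mul_two_pi_mul_I m]; congr 1; push_cast; ring
      rw [this]; simp
  change ∫ x, expo k x ∂cellMeasure = _
  rw [h1]
  simp_rw [h2]
  rw [integral_fintype_prod_eq_prod
    (f := fun (j : Fin 2) (t : ℝ) => Complex.exp (Complex.I * (k j : ℂ) * (t : ℂ)))]
  simp only [h3, Fin.prod_univ_two, funext_iff, Fin.forall_fin_two, Pi.zero_apply]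
  by_cases h0 : k 0 = 0 <;> by_cases h1 : k 1 = 0 <;> simp [h0, h1, sq]

lemma integrableOn_of_continuous {f : Plane → ℂ} (hf : Continuous f) : IntegrableOn f cell :=
  hf.continuousOn.integrableOn_compact isCompact_Icc

lemma parseval (S : Finset (Fin 2 → ℤ)) (a : (Fin 2 → ℤ) → ℂ) (f : Plane → ℝ)
    (hf : ∀ x, (f x : ℂ) = ∑ k ∈ S, a k * expo k x) :
    ∫ x in cell, f x ^ 2 = (2 * Real.pi) ^ 2 * ∑ k ∈ S, ‖a k‖ ^ 2 := by
  have h1 : ∀ x, ((f x ^ 2 : ℝ) : ℂ) =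
      ∑ k ∈ S, ∑ l ∈ S, a k * (starRingEnd ℂ) (a l) * expo (k - l) x := by
    intro x
    have h : ((f x ^ 2 : ℝ) : ℂ) = (f x : ℂ) * (starRingEnd ℂ) (f x : ℂ) := by
      rw [Complex.conj_ofReal]; push_cast; ring
    rw [h, hf, map_sum, Finset.sum_mul_sum]
    refine Finset.sum_congr rfl fun k _ => Finset.sum_congr rfl fun l _ => ?_
    have h' : expo k x * (starRingEnd ℂ) (expo l x) = expo (k - l) x := by
      rw [expo, expo, expo, ← Complex.exp_conj, ← Complex.exp_add]
      congr 1
      simp [Fin.sum_univ_two]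
      ring
    rw [map_mul, ← h']; ring
  apply Complex.ofReal_injective
  rw [← integral_complex_ofReal]
  simp_rw [h1]
  rw [integral_finsetSum _ fun k _ => integrable_finsetSum _ fun l _ =>
    (integrableOn_of_continuous (continuous_expo (k - l))).const_mul _]
  have h2 : ∀ k ∈ S, ∫ x in cell, ∑ l ∈ S, a k * (starRingEnd ℂ) (a l) * expo (k - l) x =
      (2 * Real.pi : ℂ) ^ 2 * (‖a k‖ : ℂ) ^ 2 := by
    intro k hk
    rw [integral_finsetSum _ fun l _ =>
      (integrableOn_of_continuous (continuous_expo (k - l))).const_mul _]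
    simp_rw [integral_const_mul, integral_expo, sub_eq_zero]
    simp only [mul_ite, mul_zero, Finset.sum_ite_eq, hk, if_true]
    rw [Complex.mul_conj, Complex.normSq_eq_norm_sq]; push_cast; ring
  rw [Finset.sum_congr rfl h2, ← Finset.mul_sum]
  push_cast; rfl

lemma integral_normSq (u : Plane → Vec) (hu : Continuous u) :
    ∫ x in cell, ‖u x‖ ^ 2 = ∑ i, ∫ x in cell, (u x i) ^ 2 := by
  rw [← integral_finsetSum]
  · simp [EuclideanSpace.norm_sq_eq]
  · intro i _
    exact (by fun_prop : Continuous fun x => (u x i) ^ 2).continuousOn.integrableOn_compact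
      isCompact_Icc

lemma IsTrigPoly.continuous_pderiv {u : Plane → Vec} (hu : IsTrigPoly u) (j : Fin 2) :
    Continuous (pderiv j u) := by
  obtain ⟨c, hc⟩ := hu
  suffices h0 : Continuous fun x => (pderiv j u x).ofLp from
    (PiLp.continuous_toLp 2 _).comp h0
  refine continuous_pi fun i => ?_
  have h : (fun x => pderiv j u x i) = fun x => Complex.re
      (∑ k ∈ c.support, (Complex.I * (k j : ℂ) * c k i) * expo k x) := by
    funext x; rw [← IsTrigPoly.pderiv_eq hc]; simp
  rw [h]
  refine Complex.continuous_re.comp (continuous_finsetSum _ fun k _ => ?_)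
  exact continuous_const.mul (continuous_expo k)

/-- Poincaré's inequality for the fields in `𝒱`. -/
lemma IsTestField.poincare {u : Plane → Vec} (hu : IsTestField u) :
    ∫ x in cell, ‖u x‖ ^ 2 ≤ ∑ j, ∫ x in cell, ‖pderiv j u x‖ ^ 2 := by
  have htrig := hu.trig
  obtain ⟨c, hc⟩ := hu.trig
  have h0 : c 0 = 0 := by
    funext i
    have h1 : ∫ x in cell, ((u x i : ℝ) : ℂ) = 0 := by
      rw [integral_complex_ofReal]
      have := congrArg (EuclideanSpace.proj (𝕜 := ℝ) i) hu.mean_zero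
      rw [← ContinuousLinearMap.integral_comp_comm _ htrig.integrableOn] at this
      simpa using this
    simp_rw [hc, Finsupp.sum] at h1
    rw [integral_finsetSum _ fun k _ =>
      (integrableOn_of_continuous (continuous_expo k)).const_mul _] at h1
    simp_rw [integral_const_mul, integral_expo] at h1
    simp only [mul_ite, mul_zero, Finset.sum_ite_eq', Finsupp.mem_support_iff] at h1
    by_contra hne
    have hc0 : c 0 ≠ 0 := fun h => hne (by rw [h])
    rw [if_pos hc0] at h1
    have hpi : ((2 * Real.pi) ^ 2 : ℂ) ≠ 0 := by
      have := Real.pi_ne_zero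
      simp [this]
    exact hne (by simpa [hpi] using h1)
  rw [integral_normSq u htrig.differentiable.continuous]
  simp_rw [fun j => integral_normSq (pderiv j u) (htrig.continuous_pderiv j)]
  rw [Finset.sum_comm]
  refine Finset.sum_le_sum fun i _ => ?_
  rw [parseval c.support (fun k => c k i) (fun x => u x i) (fun x => hc x i)]
  simp_rw [fun j => parseval c.support (fun k => Complex.I * (k j : ℂ) * c k i)
    (fun x => pderiv j u x i) (fun x => IsTrigPoly.pderiv_eq hc j x i)]
  rw [← Finset.mul_sum, Finset.sum_comm]
  refine mul_le_mul_of_nonneg_left (Finset.sum_le_sum fun k hk => ?_) (by positivity)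
  have hk0 : k ≠ 0 := by
    rintro rfl
    exact (Finsupp.mem_support_iff.1 hk) h0
  have h1 : (1 : ℝ) ≤ ∑ j, (k j : ℝ) ^ 2 := by
    obtain ⟨j, hj⟩ := Function.ne_iff.1 hk0
    refine le_trans ?_ (Finset.single_le_sum (f := fun j => (k j : ℝ) ^ 2)
      (fun _ _ => sq_nonneg _) (Finset.mem_univ j))
    have h2 : (1 : ℤ) ≤ k j ^ 2 := by
      have : 0 < k j ^ 2 := by have : k j ≠ 0 := hj; positivity
      omega
    exact_mod_cast h2
  have h3 : ∀ j, ‖Complex.I * (k j : ℂ) * c k i‖ ^ 2 = (k j : ℝ) ^ 2 * ‖c k i‖ ^ 2 := by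
    intro j
    rw [norm_mul, norm_mul, Complex.norm_I, one_mul, mul_pow, Complex.norm_intCast, sq_abs]
  simp_rw [h3]
  rw [← Finset.sum_mul]
  nlinarith [sq_nonneg ‖c k i‖]

/-! ### The spaces `H` and `V` -/

/-- The space `H`: the closure of `𝒱` in `L²(Ω)²`. -/
def H : Set L2 := closure {U : L2 | ∃ u, IsTestField u ∧ U =ᵐ[cellMeasure] u}

/-- The fields of `𝒱` together with their first partial derivatives, as elements of
`L²(Ω)² × (L²(Ω)²)²`. The topology of this product restricted to pairs `(u, ∇u)` is the
topology of `H¹(Ω)²`. -/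
def testGraph : Submodule ℝ (L2 × (Fin 2 → L2)) where
  carrier := {p | ∃ u, IsTestField u ∧ p.1 =ᵐ[cellMeasure] u ∧
    ∀ j, p.2 j =ᵐ[cellMeasure] pderiv j u}
  zero_mem' := by
    refine ⟨0, .zero, Lp.coeFn_zero _ _ _, fun j => ?_⟩
    filter_upwards [Lp.coeFn_zero Vec 2 cellMeasure] with x hx
    simpa [pderiv] using hx
  add_mem' := by
    rintro p q ⟨u, hu, hu1, hu2⟩ ⟨v, hv, hv1, hv2⟩
    refine ⟨u + v, hu.add hv, (Lp.coeFn_add _ _).trans (hu1.add hv1), fun j => ?_⟩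
    filter_upwards [Lp.coeFn_add (p.2 j) (q.2 j), hu2 j, hv2 j] with x h1 h2 h3
    simp only [Prod.snd_add, Pi.add_apply] at h1 ⊢
    rw [h1, h2, h3, pderiv_add hu.trig hv.trig]
  smul_mem' := by
    rintro a p ⟨u, hu, hu1, hu2⟩
    refine ⟨a • u, hu.smul a, (Lp.coeFn_smul _ _).trans (hu1.const_smul a), fun j => ?_⟩
    filter_upwards [Lp.coeFn_smul a (p.2 j), hu2 j] with x h1 h2
    simp only [Prod.smul_snd, Pi.smul_apply] at h1 ⊢
    rw [h1, h2, pderiv_smul hu.trig]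

/-- The space `V`: the closure of `𝒱` in `H¹(Ω)²`. An element is a field `u ∈ L²(Ω)²` together
with its weak partial derivatives `∂₁u, ∂₂u ∈ L²(Ω)²` (which are determined by `u`). -/
def V : Type := testGraph.topologicalClosure

instance : AddCommGroup V := inferInstanceAs (AddCommGroup testGraph.topologicalClosure)

instance : Module ℝ V := inferInstanceAs (Module ℝ testGraph.topologicalClosure)

/-- The embedding `V ⊂ L²(Ω)²`. -/
def V.field (u : V) : L2 := u.1.1

/-- The weak partial derivative `∂u/∂x_j` of `u ∈ V`. -/
def V.deriv (u : V) (j : Fin 2) : L2 := u.1.2 j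

lemma L2.norm_sq_of_ae_eq {U : L2} {u : Plane → Vec} (h : U =ᵐ[cellMeasure] u) :
    ‖U‖ ^ 2 = ∫ x in cell, ‖u x‖ ^ 2 := by
  rw [← real_inner_self_eq_norm_sq, L2.inner_def]
  refine integral_congr_ae ?_
  filter_upwards [h] with x hx
  rw [hx, real_inner_self_eq_norm_sq]

/-- Poincaré's inequality on `V`. -/
lemma V.poincare (u : V) : ‖u.field‖ ^ 2 ≤ ∑ j, ‖u.deriv j‖ ^ 2 := by
  have hcl : IsClosed {p : L2 × (Fin 2 → L2) | ‖p.1‖ ^ 2 ≤ ∑ j, ‖p.2 j‖ ^ 2} :=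
    isClosed_le (by fun_prop) (by fun_prop)
  have hsub : (testGraph : Set (L2 × (Fin 2 → L2))) ⊆
      {p : L2 × (Fin 2 → L2) | ‖p.1‖ ^ 2 ≤ ∑ j, ‖p.2 j‖ ^ 2} := by
    rintro p ⟨v, hv, h1, h2⟩
    simp only [Set.mem_ofPred_eq]
    rw [L2.norm_sq_of_ae_eq h1, Finset.sum_congr rfl fun j _ => L2.norm_sq_of_ae_eq (h2 j)]
    exact hv.poincare
  exact closure_minimal hsub hcl u.2

/-- The inner product `⟨⟨u, v⟩⟩ = ∑ⱼ ∫ ∂ⱼu · ∂ⱼv` of `V`. -/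
@[reducible]
def V.innerCore : InnerProductSpace.Core ℝ V where
  inner u v := ∑ j, inner ℝ (u.deriv j) (v.deriv j)
  conj_inner_symm u v := by
    simp only [conj_trivial]
    exact Finset.sum_congr rfl fun j _ => real_inner_comm _ _
  re_inner_nonneg u := by
    simp only [RCLike.re_to_real]
    exact Finset.sum_nonneg fun j _ => real_inner_self_nonneg
  add_left u v w := by
    have h : ∀ j, (u + v).deriv j = u.deriv j + v.deriv j := fun _ => rfl
    simp only [h, inner_add_left, Finset.sum_add_distrib]
  smul_left u v a := by
    have h : ∀ j, (a • u).deriv j = a • u.deriv j := fun _ => rfl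
    simp only [h, real_inner_smul_left, Finset.mul_sum, conj_trivial]
  definite u hu := by
    have h1 : ∑ j, ‖u.deriv j‖ ^ 2 = 0 := by
      simpa only [real_inner_self_eq_norm_sq] using hu
    have h2 : ∀ j, u.deriv j = 0 := fun j => by
      simpa using (Finset.sum_eq_zero_iff_of_nonneg fun j _ => sq_nonneg ‖u.deriv j‖).1 h1 j
        (Finset.mem_univ j)
    have h3 : u.field = 0 := by
      have h := u.poincare
      rw [h1] at h
      simpa using le_antisymm h (sq_nonneg _)
    exact Subtype.ext (Prod.ext h3 (funext h2))

/-- The norm of `V` is `‖u‖ = ⟨⟨u, u⟩⟩^{1/2}`. -/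
instance : NormedAddCommGroup V := V.innerCore.toNormedAddCommGroup

instance : InnerProductSpace ℝ V := InnerProductSpace.ofCore V.innerCore.toCore

/-! ### The operators of the stationary equation

An element of the dual space `V'` is represented by the function on `V` that it is; two elements
of `V'` are equal if and only if these functions are. -/

/-- `A u ∈ V'`, `⟨A u, φ⟩ = ⟨⟨u, φ⟩⟩`. -/
def A (u : V) : V → ℝ := fun φ => inner ℝ u φ

/-- `B(u, v) ∈ V'`, `⟨B(u, v), φ⟩ = ∫ ((u · ∇) v) · φ`. In dimension two `V ⊂ L⁴(Ω)²`, so the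
integrand is integrable. -/
def B (u v : V) : V → ℝ := fun φ =>
  ∫ x in cell, inner ℝ (∑ j, u.field x j • v.deriv j x) (φ.field x)

/-- `B_s(u, v) = B(u, v) + B(v, u)`. -/
def Bs (u v : V) : V → ℝ := B u v + B v u

/-- An element `g` of `H` as an element of `V'`, `φ ↦ ⟨g, φ⟩`. -/
def toDual (g : L2) : V → ℝ := fun φ => inner ℝ g φ.field

/-! ### Asymptotic expansions in a normed space -/

section Expansion

variable {Z : Type*} [NormedAddCommGroup Z] [NormedSpace ℝ Z]

/-- The index set `𝒩` of an expansion with `K ∈ {0, 1, 2, …, ∞}` terms: `𝒩 = ∅` if `K = 0`,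
`𝒩 = {1, …, K}` if `K` is finite, and `𝒩 = {1, 2, 3, …}` if `K = ∞`. -/
def indexSet (K : ℕ∞) : Set ℕ := {k | 1 ≤ k ∧ (k : ℕ∞) ≤ K}

/-- The relaxed expansion `xₙ ≈ v + ∑_{k ∈ 𝒩} Γ_{k,n} w_k` in `Z`: it is trivial if `K = 0`,
finite if `K < ∞`, infinite if `K = ∞`. The values of `Γ k` and `w k` for `k ∉ 𝒩` play no role. -/
structure IsRelaxedExpansion (x : ℕ → Z) (v : Z) (K : ℕ∞) (Γ : ℕ → ℕ → ℝ) (w : ℕ → Z) :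
    Prop where
  trivial : K = 0 → ∀ n, x n = v
  pos : ∀ k ∈ indexSet K, ∀ n, 0 < Γ k n
  tendsto_one : 1 ∈ indexSet K → Tendsto (Γ 1) atTop (𝓝 0)
  tendsto_ratio : ∀ k ∈ indexSet K, k + 1 ∈ indexSet K →
    Tendsto (fun n => Γ (k + 1) n / Γ k n) atTop (𝓝 0)
  /-- The vectors `r k n` are the `w_n^{(k)}`. -/
  remainder : ∃ r : ℕ → ℕ → Z,
    (∀ k ∈ indexSet K, Tendsto (r k) atTop (𝓝 (w k))) ∧
    (∀ k ∈ indexSet K, ∀ n,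
      x n = v + ∑ j ∈ Finset.Ico 1 k, Γ j n • w j + Γ k n • r k n) ∧
    (∀ k ∈ indexSet K, (k : ℕ∞) = K → ∀ n, r k n = w k)
  last_ne_zero : ∀ k ∈ indexSet K, (k : ℕ∞) = K → w k ≠ 0

/-- Unitary expansions: all the `w_k` are unit vectors. -/
def IsUnitaryExpansion (x : ℕ → Z) (v : Z) (K : ℕ∞) (Γ : ℕ → ℕ → ℝ) (w : ℕ → Z) : Prop :=
  IsRelaxedExpansion x v K Γ w ∧ ∀ k ∈ indexSet K, ‖w k‖ = 1

/-- Degenerate expansions: infinite, and either all the `w_k` are zero, or the first `N ≥ 1` of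
them are unit vectors and the others are zero. -/
def IsDegenerateExpansion (x : ℕ → Z) (v : Z) (K : ℕ∞) (Γ : ℕ → ℕ → ℝ) (w : ℕ → Z) : Prop :=
  IsRelaxedExpansion x v K Γ w ∧ K = ⊤ ∧
    ((∀ k, 1 ≤ k → w k = 0) ∨
      ∃ N, 1 ≤ N ∧ (∀ k, 1 ≤ k → k ≤ N → ‖w k‖ = 1) ∧ ∀ k, N < k → w k = 0)

end Expansion

/-! ### Comparison of sequences of positive numbers -/

/-- `ξ ≻ η`. -/
def Dominates (ξ η : ℕ → ℝ) : Prop := Tendsto (fun n => ξ n / η n) atTop atTop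

/-- `ξ ∼ η`. -/
def Comparable (ξ η : ℕ → ℝ) : Prop := ∃ l : ℝ, 0 < l ∧ Tendsto (fun n => ξ n / η n) atTop (𝓝 l)

/-- `ξ ≿ η`: `ξ ≻ η` or `ξ ∼ η`. -/
def DominatesOrComparable (ξ η : ℕ → ℝ) : Prop := Dominates ξ η ∨ Comparable ξ η

scoped infix:50 " ≻ₛ " => Dominates
scoped infix:50 " ∼ₛ " => Comparable
scoped infix:50 " ≿ₛ " => DominatesOrComparable

/-- A set of sequences of positive numbers is totally comparable if any two of its members satisfy
`ξ ∼ η` or `ξ ≻ η` or `η ≻ ξ`. -/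
def TotallyComparable (X : Set (ℕ → ℝ)) : Prop :=
  ∀ ξ ∈ X, ∀ η ∈ X, ξ ∼ₛ η ∨ ξ ≻ₛ η ∨ η ≻ₛ ξ

/-- The set `𝒮` of the sequences `(αₙ)`, `(1)`, `(Γ_{k,n})`, `(αₙ Γ_{k,n})` and
`(αₙ Γ_{j,n} Γ_{k,n})`, for `j, k ∈ 𝒩`. -/
def coeffSet (α : ℕ → ℝ) (K : ℕ∞) (Γ : ℕ → ℕ → ℝ) : Set (ℕ → ℝ) :=
  {α, 1} ∪ {ξ | ∃ k ∈ indexSet K, ξ = Γ k ∨ ξ = fun n => α n * Γ k n} ∪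
    {ξ | ∃ j ∈ indexSet K, ∃ k ∈ indexSet K, j ≤ k ∧ ξ = fun n => α n * Γ j n * Γ k n}

/-- The assumption on the sequence `χ`: it is identically zero, or it is positive and totally
comparable with the sequences of `S`, or it is negative and `-χ` is totally comparable with the
sequences of `S`. -/
def SignedComparable (S : Set (ℕ → ℝ)) (χ : ℕ → ℝ) : Prop :=
  (∀ n, χ n = 0) ∨
    ((∀ n, 0 < χ n) ∧ TotallyComparable (S ∪ {χ})) ∨
    ((∀ n, χ n < 0) ∧ TotallyComparable (S ∪ {-χ}))

end

end PeriodicNSE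

open PeriodicNSE

namespace PeriodicNSE

/-! The argument is a balance of orders in the steady equation. Two facts about the trilinear form
make it work. It is continuous on V, because V embeds into L⁴ (`V.eLpNorm_four_le`, `abs_B_le`), so
limits pass through products. It is antisymmetric in its last two arguments (`B_antisymm`), so
⟨B(u,v),v⟩ = 0.

With x = Γ₁w₁ + Γ₂r and r → w₂, the equation becomes a sum of convergent functionals with scalar
weights Γ₁, Γ₂, αΓ₁², αΓ₁Γ₂ (`steady_two_terms`). Since g ≠ 0 and the linear terms vanish in the
limit, some nonlinear weight must stay away from 0, and total comparability says which limits are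
possible (`steady_leading`, `steady_second`). A single term a·w cannot solve the equation: testing
with w removes the nonlinearity and leaves the energy (`steady_single_eq_zero`).

When αΓ₁² → μ, the leading term reproduces g up to the defect χ·g (`steady_defect`). Dividing by the
larger of the orders Γ₁ and αΓ₁Γ₂ of the remaining terms leaves functionals that converge and equal
a scalar multiple of g. As g ≠ 0, χ cannot dominate that order, and the ratio to χ identifies the
limit (`balance`). The scalar relations come from testing the limit equations with w₁ and w₂. -/

/-! ### A Ladyzhenskaya-type inequality on the cell. -/

lemma norm_sq_le_intervalIntegral {E : Type*} [NormedAddCommGroup E] [InnerProductSpace ℝ E]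
    {h h' : ℝ → E} {L : ℝ} (hL : 1 ≤ L) (hd : ∀ t, HasDerivAt h (h' t) t) (hc : Continuous h')
    {s : ℝ} (hs : s ∈ Set.Icc 0 L) :
    ‖h s‖ ^ 2 ≤ ∫ t in (0 : ℝ)..L, (2 * ‖h t‖ ^ 2 + ‖h' t‖ ^ 2) := by
  have hcont : Continuous h := continuous_iff_continuousAt.2 fun t => (hd t).continuousAt
  have h0L : (0 : ℝ) ≤ L := by linarith
  set C := ∫ t in (0 : ℝ)..L, (‖h t‖ ^ 2 + ‖h' t‖ ^ 2) with hC
  -- Integrate (‖h‖²)' = 2⟨h, h'⟩ ≤ ‖h‖² + ‖h'‖² between t and s.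
  have key : ∀ t ∈ Set.Icc 0 L, ‖h s‖ ^ 2 ≤ ‖h t‖ ^ 2 + C := by
    intro t ht
    have h1 : ∫ r in t..s, 2 * inner ℝ (h r) (h' r) = ‖h s‖ ^ 2 - ‖h t‖ ^ 2 :=
      intervalIntegral.integral_eq_sub_of_hasDerivAt (fun r _ => (hd r).norm_sq)
        (Continuous.intervalIntegrable (by fun_prop) _ _)
    have h2 : ‖∫ r in t..s, 2 * inner ℝ (h r) (h' r)‖ ≤
        |∫ r in t..s, (‖h r‖ ^ 2 + ‖h' r‖ ^ 2)| := by
      refine intervalIntegral.norm_integral_le_abs_of_norm_le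
        (g := fun r => ‖h r‖ ^ 2 + ‖h' r‖ ^ 2) (ae_of_all _ fun r => ?_)
        (Continuous.intervalIntegrable (by fun_prop) _ _)
      rw [Real.norm_eq_abs, abs_mul, abs_two]
      nlinarith [abs_real_inner_le_norm (h r) (h' r), sq_nonneg (‖h r‖ - ‖h' r‖)]
    have h3 : |∫ r in t..s, (‖h r‖ ^ 2 + ‖h' r‖ ^ 2)| ≤
        |∫ r in (0 : ℝ)..L, (‖h r‖ ^ 2 + ‖h' r‖ ^ 2)| := by
      refine intervalIntegral.abs_integral_mono_interval ?_ (ae_of_all _ fun r => by positivity)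
        (Continuous.intervalIntegrable (by fun_prop) _ _)
      rw [Set.uIoc_of_le h0L]
      exact Set.Ioc_subset_Ioc (le_min ht.1 hs.1) (max_le ht.2 hs.2)
    have h4 : 0 ≤ C := intervalIntegral.integral_nonneg h0L fun r _ => by positivity
    rw [abs_of_nonneg h4] at h3
    linarith [Real.le_norm_self (∫ r in t..s, 2 * inner ℝ (h r) (h' r))]
  -- Averaging `key` over t puts a factor L in front of ‖h s‖² - C; since L ≥ 1 it can be dropped at
  -- the end.
  have h5 : ∫ _ in (0 : ℝ)..L, (‖h s‖ ^ 2 - C) ≤ ∫ t in (0 : ℝ)..L, ‖h t‖ ^ 2 :=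
    intervalIntegral.integral_mono_on h0L (by simp)
      (Continuous.intervalIntegrable (by fun_prop) _ _) fun t ht => by linarith [key t ht]
  have h6 : ∫ t in (0 : ℝ)..L, (2 * ‖h t‖ ^ 2 + ‖h' t‖ ^ 2) =
      (∫ t in (0 : ℝ)..L, ‖h t‖ ^ 2) + C := by
    rw [hC, ← intervalIntegral.integral_add (Continuous.intervalIntegrable (by fun_prop) _ _)
      (Continuous.intervalIntegrable (by fun_prop) _ _)]
    congr 1; ext t; ring
  rw [h6]
  have h7 : 0 ≤ ∫ t in (0 : ℝ)..L, ‖h t‖ ^ 2 :=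
    intervalIntegral.integral_nonneg h0L fun r _ => by positivity
  simp only [intervalIntegral.integral_const, sub_zero, smul_eq_mul] at h5
  by_contra! h8
  nlinarith

lemma cellMeasure_eq_pi : cellMeasure =
    Measure.pi (fun _ : Fin 2 => (volume : Measure ℝ).restrict (Set.Icc 0 (2 * Real.pi))) := by
  rw [← Measure.restrict_pi_pi, Set.pi_univ_Icc]; rfl

/-- The Ladyzhenskaya-type bound of a continuously differentiable field on the cell. -/
lemma lintegral_norm_pow_four_le {u : Plane → Vec} (hu : Differentiable ℝ u)
    (hc : ∀ j, Continuous (pderiv j u)) :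
    ∫⁻ x, ENNReal.ofReal (‖u x‖ ^ 4) ∂cellMeasure ≤
      (∫⁻ x, ENNReal.ofReal (2 * ‖u x‖ ^ 2 + ∑ j, ‖pderiv j u x‖ ^ 2) ∂cellMeasure) ^ 2 := by
  have hu0 := hu.continuous
  have hpi : (1 : ℝ) ≤ 2 * Real.pi := by linarith [Real.pi_gt_three]
  set f : Plane → ENNReal :=
    fun x => ENNReal.ofReal (2 * ‖u x‖ ^ 2 + ∑ j, ‖pderiv j u x‖ ^ 2) with hf
  have hfm : Measurable f := by
    have : Continuous f := by
      refine ENNReal.continuous_ofReal.comp ?_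
      fun_prop
    exact this.measurable
  -- In each direction, |u(x)|² is controlled by the integral of `f` over the line through x.
  have hline : ∀ x ∈ cell, ∀ i, ENNReal.ofReal (‖u x‖ ^ 2) ≤
      ∫⁻ t in Set.Icc 0 (2 * Real.pi), f (Function.update x i t) := by
    intro x hx i
    have hd : ∀ t, HasDerivAt (fun t => u (Function.update x i t))
        (pderiv i u (Function.update x i t)) t := by
      intro t
      exact (hu _).hasFDerivAt.comp_hasDerivAt t (hasDerivAt_update x i t)
    have hcu : Continuous fun t : ℝ => Function.update x i t := by fun_prop
    have h1 := norm_sq_le_intervalIntegral hpi hd ((hc i).comp hcu)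
      (s := x i) ⟨hx.1 i, hx.2 i⟩
    rw [Function.update_eq_self, intervalIntegral.integral_of_le (by linarith),
      ← integral_Icc_eq_integral_Ioc] at h1
    refine (ENNReal.ofReal_le_ofReal h1).trans ?_
    have hc' := (hc i).comp hcu
    have hu' := hu0.comp hcu
    simp only [Function.comp_def] at hc' hu'
    rw [ofReal_integral_eq_lintegral_ofReal]
    · refine lintegral_mono fun t => ENNReal.ofReal_le_ofReal ?_
      have := Finset.single_le_sum (f := fun j => ‖pderiv j u (Function.update x i t)‖ ^ 2)
        (fun _ _ => sq_nonneg _) (Finset.mem_univ i)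
      linarith
    · exact Continuous.integrableOn_Icc (by fun_prop)
    · exact ae_of_all _ fun t => by positivity
  have hconj : Real.HolderConjugate (Fintype.card (Fin 2)) 2 := by
    have : Real.HolderConjugate 2 2 := Real.HolderConjugate.two_two
    simpa using this
  -- The grid-lines inequality in dimension two: the product of the two line integrals of `f` has
  -- integral at most (∫ f)². Using one direction for each factor |u|² bounds |u|⁴.
  have hgrid := lintegral_prod_lintegral_pow_le
    (fun _ : Fin 2 => (volume : Measure ℝ).restrict (Set.Icc 0 (2 * Real.pi))) hconj hfm
  rw [← cellMeasure_eq_pi] at hgrid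
  rw [← ENNReal.rpow_natCast, Nat.cast_ofNat]
  refine (setLIntegral_mono_ae' (μ := volume) (s := cell) measurableSet_Icc
    (ae_of_all _ fun x hx => ?_)).trans hgrid
  simp only [Fintype.card_fin, Nat.cast_ofNat, Fin.prod_univ_two]
  rw [show (1 : ℝ) / (2 - 1) = 1 by norm_num, ENNReal.rpow_one, ENNReal.rpow_one,
    show ‖u x‖ ^ 4 = ‖u x‖ ^ 2 * ‖u x‖ ^ 2 by ring, ENNReal.ofReal_mul (by positivity)]
  exact mul_le_mul' (hline x hx 0) (hline x hx 1)

instance : IsFiniteMeasure cellMeasure :=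
  ⟨by
    rw [cellMeasure, Measure.restrict_apply_univ]
    exact isCompact_Icc.measure_lt_top⟩

/-! ### The norm of V and approximation by test fields. -/

lemma V.field_add (u v : V) : (u + v).field = u.field + v.field := rfl
lemma V.field_smul (a : ℝ) (u : V) : (a • u).field = a • u.field := rfl
lemma V.deriv_add (u v : V) (j : Fin 2) : (u + v).deriv j = u.deriv j + v.deriv j := rfl
lemma V.deriv_smul (a : ℝ) (u : V) (j : Fin 2) : (a • u).deriv j = a • u.deriv j := rfl

lemma V.norm_sq_eq (u : V) : ‖u‖ ^ 2 = ∑ j, ‖u.deriv j‖ ^ 2 := by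
  rw [← real_inner_self_eq_norm_sq]
  change ∑ j, inner ℝ (u.deriv j) (u.deriv j) = _
  simp only [real_inner_self_eq_norm_sq]

lemma V.norm_field_le (u : V) : ‖u.field‖ ≤ ‖u‖ := by
  have h := u.poincare
  rw [← u.norm_sq_eq] at h
  exact (sq_le_sq₀ (norm_nonneg _) (norm_nonneg _)).1 h

lemma V.norm_deriv_le (u : V) (j : Fin 2) : ‖u.deriv j‖ ≤ ‖u‖ := by
  refine (sq_le_sq₀ (norm_nonneg _) (norm_nonneg _)).1 ?_
  rw [u.norm_sq_eq]
  exact Finset.single_le_sum (f := fun j => ‖u.deriv j‖ ^ 2) (fun _ _ => sq_nonneg _)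
    (Finset.mem_univ j)

/-- The set `𝒱` as a subset of `V`. -/
def V.IsTest (U : V) : Prop :=
  ∃ u, IsTestField u ∧ U.field =ᵐ[cellMeasure] u ∧ ∀ j, U.deriv j =ᵐ[cellMeasure] pderiv j u

/-- The closure defining V is taken for pairs (u, ∇u), whereas the norm of V sees only the
derivatives; convergence of the pairs implies convergence in this norm. -/
lemma V.exists_seq_tendsto (U : V) :
    ∃ s : ℕ → V, (∀ n, (s n).IsTest) ∧ Tendsto s atTop (𝓝 U) := by
  obtain ⟨p, hp, hlim⟩ := mem_closure_iff_seq_limit.1 U.2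
  let s : ℕ → V := fun n => ⟨p n, testGraph.le_topologicalClosure (hp n)⟩
  refine ⟨s, fun n => hp n, ?_⟩
  rw [tendsto_iff_norm_sub_tendsto_zero]
  have h1 : Tendsto (fun n => √(∑ j, ‖(p n).2 j - U.deriv j‖ ^ 2)) atTop (𝓝 0) := by
    have hc : Continuous fun q : L2 × (Fin 2 → L2) => √(∑ j, ‖q.2 j - U.deriv j‖ ^ 2) := by
      fun_prop
    have h := (hc.tendsto U.1).comp hlim
    have h0 : √(∑ j, ‖U.1.2 j - U.deriv j‖ ^ 2) = 0 := by
      simp [V.deriv]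
    rwa [h0] at h
  refine h1.congr fun n => ?_
  rw [Real.sqrt_eq_iff_eq_sq (Finset.sum_nonneg fun _ _ => sq_nonneg _) (norm_nonneg _),
    V.norm_sq_eq]
  rfl

lemma memLp_of_continuous {u : Plane → Vec} (hu : Continuous u) (p : ENNReal) :
    MemLp u p cellMeasure := by
  obtain ⟨C, hC⟩ := isCompact_Icc.exists_bound_of_continuousOn (s := cell) hu.continuousOn
  refine MemLp.of_bound hu.aestronglyMeasurable C ?_
  exact (ae_restrict_iff' measurableSet_Icc).2 (ae_of_all _ hC)

lemma IsTestField.exists_isTest {u : Plane → Vec} (hu : IsTestField u) :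
    ∃ U : V, U.field =ᵐ[cellMeasure] u ∧ ∀ j, U.deriv j =ᵐ[cellMeasure] pderiv j u := by
  have h0 := memLp_of_continuous hu.trig.differentiable.continuous 2
  have h1 := fun j => memLp_of_continuous (hu.trig.continuous_pderiv j) 2
  refine ⟨⟨(h0.toLp u, fun j => (h1 j).toLp _), testGraph.le_topologicalClosure
    ⟨u, hu, h0.coeFn_toLp, fun j => (h1 j).coeFn_toLp⟩⟩, h0.coeFn_toLp, fun j => (h1 j).coeFn_toLp⟩

/-- Orthogonality to 𝒱 extends to its L²-closure, which contains g itself. This is how g ≠ 0 enters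
the equation in V'. -/
lemma eq_zero_of_toDual_eq_zero {g : L2} (hg : g ∈ H) (h : toDual g = 0) : g = 0 := by
  have hcl : IsClosed {U : L2 | inner ℝ g U = 0} := isClosed_eq (by fun_prop) continuous_const
  have hsub : {U : L2 | ∃ u, IsTestField u ∧ U =ᵐ[cellMeasure] u} ⊆ {U : L2 | inner ℝ g U = 0} := by
    rintro U ⟨u, hu, hU⟩
    obtain ⟨W, hW, -⟩ := hu.exists_isTest
    have h1 : U = W.field := Lp.ext (hU.trans hW.symm)
    rw [Set.mem_ofPred_eq, h1]
    exact congrFun h W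
  exact inner_self_eq_zero.1 (closure_minimal hsub hcl hg)

/-! ### The embedding of `V` into `L⁴` -/

lemma V.IsTest.eLpNorm_four_le {U : V} (hU : U.IsTest) :
    eLpNorm U.field 4 cellMeasure ≤ ENNReal.ofReal (2 * ‖U‖) := by
  obtain ⟨u, hu, h0, h1⟩ := hU
  have hd := hu.trig.differentiable
  have hu0 := hd.continuous
  have hu1 := hu.trig.continuous_pderiv
  have hint : ∀ f : Plane → ℝ, Continuous f → Integrable f cellMeasure := fun f hf =>
    hf.continuousOn.integrableOn_compact isCompact_Icc
  -- Poincaré's inequality gives the constant 2 + 1 = 3; it is enlarged to 4 so that the final bound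
  -- is (4‖U‖²)² = (2‖U‖)⁴.
  have h2 : ∫⁻ x, ENNReal.ofReal (2 * ‖u x‖ ^ 2 + ∑ j, ‖pderiv j u x‖ ^ 2) ∂cellMeasure ≤
      ENNReal.ofReal (4 * ‖U‖ ^ 2) := by
    rw [← ofReal_integral_eq_lintegral_ofReal (hint _ (by fun_prop))
      (ae_of_all _ fun x => by positivity)]
    refine ENNReal.ofReal_le_ofReal ?_
    rw [integral_add (hint _ (by fun_prop)) (hint _ (by fun_prop)), integral_const_mul,
      integral_finsetSum _ fun j _ => hint _ (by fun_prop)]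
    have h3 := L2.norm_sq_of_ae_eq h0
    have h4 := fun j => L2.norm_sq_of_ae_eq (h1 j)
    have h5 : ∫ x, ‖u x‖ ^ 2 ∂cellMeasure = ‖U.field‖ ^ 2 := h3.symm
    have h6 : ∑ j, ∫ x, ‖pderiv j u x‖ ^ 2 ∂cellMeasure = ‖U‖ ^ 2 := by
      rw [V.norm_sq_eq]; exact Finset.sum_congr rfl fun j _ => (h4 j).symm
    rw [h5, h6]
    have h7 := U.poincare
    rw [← V.norm_sq_eq] at h7
    nlinarith [sq_nonneg ‖U‖]
  have h8 := (lintegral_norm_pow_four_le hd hu1).trans (pow_le_pow_left₀ zero_le h2 2)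
  rw [eLpNorm_congr_ae h0, eLpNorm_eq_lintegral_rpow_enorm_toReal (by norm_num) (by norm_num)]
  rw [one_div, ENNReal.rpow_inv_le_iff (by norm_num), ENNReal.toReal_ofNat]
  have h9 : ∫⁻ x, ‖u x‖ₑ ^ (4 : ℝ) ∂cellMeasure =
      ∫⁻ x, ENNReal.ofReal (‖u x‖ ^ 4) ∂cellMeasure := by
    refine lintegral_congr fun x => ?_
    rw [ENNReal.ofReal_pow (norm_nonneg _), ofReal_norm]
    exact_mod_cast ENNReal.rpow_natCast _ 4
  rw [h9]
  refine h8.trans (le_of_eq ?_)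
  rw [← ENNReal.ofReal_pow (by positivity), ENNReal.ofReal_rpow_of_nonneg (by positivity) (by norm_num)]
  congr 1
  rw [show (4 : ℝ) = ((4 : ℕ) : ℝ) by norm_num, Real.rpow_natCast]
  push_cast; ring

/-- The bound for test fields survives the limit because the L⁴ norm is lower semicontinuous (Fatou)
along an a.e. convergent subsequence. -/
lemma V.eLpNorm_four_le (U : V) : eLpNorm U.field 4 cellMeasure ≤ ENNReal.ofReal (2 * ‖U‖) := by
  obtain ⟨s, hs, hlim⟩ := U.exists_seq_tendsto
  have h1 : Tendsto (fun n => (s n).field) atTop (𝓝 U.field) := by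
    rw [tendsto_iff_norm_sub_tendsto_zero] at hlim ⊢
    exact squeeze_zero (fun _ => norm_nonneg _) (fun n => ((s n) - U).norm_field_le) hlim
  obtain ⟨ns, hns, hae⟩ := (tendstoInMeasure_of_tendsto_Lp h1).exists_seq_tendsto_ae
  refine (Lp.eLpNorm_lim_le_liminf_eLpNorm
    (fun n => (Lp.aestronglyMeasurable (s (ns n)).field)) _ hae).trans ?_
  have h2 : Tendsto (fun n => ENNReal.ofReal (2 * ‖s (ns n)‖)) atTop
      (𝓝 (ENNReal.ofReal (2 * ‖U‖))) :=
    ENNReal.tendsto_ofReal ((hlim.comp hns.tendsto_atTop).norm.const_mul 2)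
  rw [← h2.liminf_eq]
  exact liminf_le_liminf (Eventually.of_forall fun n => (hs (ns n)).eLpNorm_four_le)

/-! ### The trilinear form -/

instance : ENNReal.HolderTriple 4 4 2 where
  inv_add_inv_eq_inv := by
    rw [← two_mul, show (4 : ENNReal) = 2 * 2 by norm_num,
      ENNReal.mul_inv (by simp) (by simp), ← mul_assoc,
      ENNReal.mul_inv_cancel (by simp) (by simp), one_mul]

lemma V.aestronglyMeasurable_apply (u : V) (j : Fin 2) :
    AEStronglyMeasurable (fun x => u.field x j) cellMeasure :=
  (EuclideanSpace.proj (𝕜 := ℝ) j).continuous.comp_aestronglyMeasurable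
    (Lp.aestronglyMeasurable u.field)

/-- The `j`-th summand of the integrand of `⟨B(u, v), φ⟩`. -/
noncomputable def advection (u v φ : V) (j : Fin 2) (x : Plane) : ℝ :=
  inner ℝ (u.field x j • v.deriv j x) (φ.field x)

lemma aestronglyMeasurable_advection (u v φ : V) (j : Fin 2) :
    AEStronglyMeasurable (advection u v φ j) cellMeasure :=
  ((u.aestronglyMeasurable_apply j).smul (Lp.aestronglyMeasurable _)).inner
    (Lp.aestronglyMeasurable _)

/-- Hölder's inequality with 1/4 + 1/4 + 1/2 = 1: u and φ are taken in L⁴, each with constant 2, and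
the derivative of v in L². -/
lemma eLpNorm_advection_le (u v φ : V) (j : Fin 2) :
    eLpNorm (advection u v φ j) 1 cellMeasure ≤ ENNReal.ofReal (4 * ‖u‖ * ‖v‖ * ‖φ‖) := by
  have hu := u.aestronglyMeasurable_apply j
  have hφ := Lp.aestronglyMeasurable φ.field
  have h1 : eLpNorm (fun x => u.field x j) 4 cellMeasure ≤ ENNReal.ofReal (2 * ‖u‖) :=
    (eLpNorm_mono fun x => PiLp.norm_apply_le _ _).trans u.eLpNorm_four_le
  have h2 : eLpNorm ((fun x => u.field x j) • (φ.field : Plane → Vec)) 2 cellMeasure ≤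
      ENNReal.ofReal (2 * ‖u‖) * ENNReal.ofReal (2 * ‖φ‖) :=
    (eLpNorm_smul_le_mul_eLpNorm (p := 4) (q := 4) hφ hu).trans
      (mul_le_mul' h1 φ.eLpNorm_four_le)
  have h3 : eLpNorm (v.deriv j) 2 cellMeasure ≤ ENNReal.ofReal ‖v‖ := by
    rw [← Lp.enorm_def, ← ofReal_norm]
    exact ENNReal.ofReal_le_ofReal (v.norm_deriv_le j)
  have h4 := eLpNorm_le_eLpNorm_mul_eLpNorm'_of_norm (p := 2) (q := 2) (r := 1) (hu.smul hφ)
    (Lp.aestronglyMeasurable (v.deriv j)) (fun a b : Vec => inner ℝ a b) 1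
    (ae_of_all _ fun x => by
      simpa using norm_inner_le_norm (𝕜 := ℝ) (((fun x => u.field x j) • (φ.field : Plane → Vec)) x)
        (v.deriv j x))
  have h5 : advection u v φ j = fun x =>
      inner ℝ (((fun x => u.field x j) • (φ.field : Plane → Vec)) x) (v.deriv j x) := by
    ext x
    simp only [advection, Pi.smul_apply', real_inner_smul_left]
    rw [real_inner_comm]
  rw [h5]
  refine h4.trans ?_
  rw [ENNReal.coe_one, one_mul]
  refine (mul_le_mul' h2 h3).trans (le_of_eq ?_)
  rw [← ENNReal.ofReal_mul (by positivity), ← ENNReal.ofReal_mul (by positivity)]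
  congr 1; ring

lemma integrable_advection (u v φ : V) (j : Fin 2) :
    Integrable (advection u v φ j) cellMeasure :=
  memLp_one_iff_integrable.1 ⟨aestronglyMeasurable_advection u v φ j,
    (eLpNorm_advection_le u v φ j).trans_lt ENNReal.ofReal_lt_top⟩

lemma B_eq_sum (u v φ : V) : B u v φ = ∑ j, ∫ x, advection u v φ j x ∂cellMeasure := by
  rw [← integral_finsetSum _ fun j _ => integrable_advection u v φ j]
  simp only [B, advection, sum_inner]
  rfl

lemma abs_B_le (u v φ : V) : |B u v φ| ≤ 8 * ‖u‖ * ‖v‖ * ‖φ‖ := by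
  have h : ∀ j, |∫ x, advection u v φ j x ∂cellMeasure| ≤ 4 * ‖u‖ * ‖v‖ * ‖φ‖ := by
    intro j
    have h1 := ENNReal.toReal_mono ENNReal.ofReal_ne_top (eLpNorm_advection_le u v φ j)
    rw [ENNReal.toReal_ofReal (by positivity), eLpNorm_one_eq_lintegral_enorm,
      ← integral_norm_eq_lintegral_enorm (aestronglyMeasurable_advection u v φ j)] at h1
    exact (norm_integral_le_integral_norm _).trans h1
  rw [B_eq_sum]
  refine (Finset.abs_sum_le_sum_abs _ _).trans ((Finset.sum_le_sum fun j _ => h j).trans ?_)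
  rw [Finset.sum_const, Finset.card_univ, Fintype.card_fin, nsmul_eq_mul]
  push_cast
  linarith

lemma B_add_left (u u' v φ : V) : B (u + u') v φ = B u v φ + B u' v φ := by
  simp only [B_eq_sum, ← Finset.sum_add_distrib]
  refine Finset.sum_congr rfl fun j _ => ?_
  rw [← integral_add (integrable_advection _ _ _ _) (integrable_advection _ _ _ _)]
  refine integral_congr_ae ?_
  filter_upwards [Lp.coeFn_add u.field u'.field] with x hx
  simp only [advection, V.field_add, hx, Pi.add_apply, PiLp.add_apply, add_smul, inner_add_left]

lemma B_add_middle (u v v' φ : V) : B u (v + v') φ = B u v φ + B u v' φ := by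
  simp only [B_eq_sum, ← Finset.sum_add_distrib]
  refine Finset.sum_congr rfl fun j _ => ?_
  rw [← integral_add (integrable_advection _ _ _ _) (integrable_advection _ _ _ _)]
  refine integral_congr_ae ?_
  filter_upwards [Lp.coeFn_add (v.deriv j) (v'.deriv j)] with x hx
  simp only [advection, V.deriv_add, hx, Pi.add_apply, smul_add, inner_add_left]

lemma B_add_right (u v φ φ' : V) : B u v (φ + φ') = B u v φ + B u v φ' := by
  simp only [B_eq_sum, ← Finset.sum_add_distrib]
  refine Finset.sum_congr rfl fun j _ => ?_
  rw [← integral_add (integrable_advection _ _ _ _) (integrable_advection _ _ _ _)]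
  refine integral_congr_ae ?_
  filter_upwards [Lp.coeFn_add φ.field φ'.field] with x hx
  simp only [advection, V.field_add, hx, Pi.add_apply, inner_add_right]

lemma B_smul_left (a : ℝ) (u v φ : V) : B (a • u) v φ = a * B u v φ := by
  simp only [B_eq_sum, Finset.mul_sum]
  refine Finset.sum_congr rfl fun j _ => ?_
  rw [← integral_const_mul]
  refine integral_congr_ae ?_
  filter_upwards [Lp.coeFn_smul a u.field] with x hx
  simp only [advection, V.field_smul, hx, Pi.smul_apply, PiLp.smul_apply, smul_eq_mul,
    real_inner_smul_left, mul_assoc]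

lemma B_smul_middle (a : ℝ) (u v φ : V) : B u (a • v) φ = a * B u v φ := by
  simp only [B_eq_sum, Finset.mul_sum]
  refine Finset.sum_congr rfl fun j _ => ?_
  rw [← integral_const_mul]
  refine integral_congr_ae ?_
  filter_upwards [Lp.coeFn_smul a (v.deriv j)] with x hx
  simp only [advection, V.deriv_smul, hx, Pi.smul_apply, real_inner_smul_left, mul_left_comm]

lemma B_smul_right (a : ℝ) (u v φ : V) : B u v (a • φ) = a * B u v φ := by
  simp only [B_eq_sum, Finset.mul_sum]
  refine Finset.sum_congr rfl fun j _ => ?_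
  rw [← integral_const_mul]
  refine integral_congr_ae ?_
  filter_upwards [Lp.coeFn_smul a φ.field] with x hx
  simp only [advection, V.field_smul, hx, Pi.smul_apply, real_inner_smul_right]

/-- The element `B(u, v)` of the dual space of `V`. -/
noncomputable def advectionDual (u v : V) : V →L[ℝ] ℝ :=
  LinearMap.mkContinuous
    { toFun := B u v
      map_add' := B_add_right u v
      map_smul' := fun a φ => B_smul_right a u v φ } (8 * ‖u‖ * ‖v‖) (abs_B_le u v)

lemma advectionDual_apply (u v φ : V) : advectionDual u v φ = B u v φ :=
  LinearMap.mkContinuous_apply _ _ _ _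

/-- The trilinear form `⟨B(u, v), φ⟩` as a continuous multilinear map. -/
noncomputable def trilinear : V →L[ℝ] V →L[ℝ] V →L[ℝ] ℝ :=
  LinearMap.mkContinuous₂
    (LinearMap.mk₂ ℝ advectionDual
      (fun u u' v => by ext φ; simp [advectionDual_apply, B_add_left])
      (fun a u v => by ext φ; simp [advectionDual_apply, B_smul_left])
      (fun u v v' => by ext φ; simp [advectionDual_apply, B_add_middle])
      (fun a u v => by ext φ; simp [advectionDual_apply, B_smul_middle])) 8
    (fun u v => LinearMap.mkContinuous_norm_le _ (by positivity) (abs_B_le u v))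

lemma trilinear_apply (u v φ : V) : trilinear u v φ = B u v φ := advectionDual_apply u v φ

lemma tendsto_trilinear {E ι : Type*} [NormedAddCommGroup E] [NormedSpace ℝ E] {l : Filter ι}
    (T : E →L[ℝ] E →L[ℝ] E →L[ℝ] ℝ) {a b c : ι → E} {u v φ : E} (ha : Tendsto a l (𝓝 u))
    (hb : Tendsto b l (𝓝 v)) (hc : Tendsto c l (𝓝 φ)) :
    Tendsto (fun i => T (a i) (b i) (c i)) l (𝓝 (T u v φ)) := by
  have h : Continuous fun p : E × E × E => T p.1 p.2.1 p.2.2 := by fun_prop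
  have h' : Tendsto (fun i => (a i, b i, c i)) l (𝓝 (u, v, φ)) :=
    ha.prodMk_nhds (hb.prodMk_nhds hc)
  simpa only [Function.comp_def] using Tendsto.comp (h.tendsto (u, v, φ)) h'

lemma tendsto_B {ι : Type*} {l : Filter ι} {a b c : ι → V} {u v φ : V} (ha : Tendsto a l (𝓝 u))
    (hb : Tendsto b l (𝓝 v)) (hc : Tendsto c l (𝓝 φ)) :
    Tendsto (fun i => B (a i) (b i) (c i)) l (𝓝 (B u v φ)) := by
  have h := tendsto_trilinear trilinear ha hb hc
  simpa only [trilinear_apply] using h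

/-! ### Antisymmetry of the trilinear form -/

lemma expo_add_single (k : Fin 2 → ℤ) (i : Fin 2) (x : Plane) :
    expo k (x + Pi.single i (2 * Real.pi)) = expo k x := by
  have h : Complex.I * ∑ j, (k j : ℂ) * (((x + Pi.single i (2 * Real.pi) : Plane) j : ℝ) : ℂ) =
      Complex.I * ∑ j, (k j : ℂ) * (x j : ℂ) + (k i : ℂ) * (2 * Real.pi * Complex.I) := by
    fin_cases i <;> simp [Fin.sum_univ_two] <;> ring
  rw [expo, h, Complex.exp_add, Complex.exp_int_mul_two_pi_mul_I, mul_one, expo]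

lemma IsTrigPoly.periodic {u : Plane → Vec} (hu : IsTrigPoly u) (i : Fin 2) (x : Plane) :
    u (x + Pi.single i (2 * Real.pi)) = u x := by
  obtain ⟨c, hc⟩ := hu
  ext l
  apply Complex.ofReal_injective
  rw [hc, hc]
  simp only [expo_add_single]

/-- The divergence of a periodic field has zero mean. -/
lemma integral_divergence_eq_zero {F : Plane → Plane} {F' : Plane → Plane →L[ℝ] Plane}
    (hF : ∀ x, HasFDerivAt F (F' x) x)
    (hper : ∀ i x, F (x + Pi.single i (2 * Real.pi)) = F x)
    (hcont : Continuous fun x => ∑ i, F' x (Pi.single i 1) i) :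
    ∫ x in cell, ∑ i, F' x (Pi.single i 1) i = 0 := by
  have h0 : (0 : Plane) ≤ fun _ => 2 * Real.pi := fun _ => by
    have := Real.pi_pos
    simp only [Pi.zero_apply]; positivity
  rw [cell, integral_divergence_of_hasFDerivAt_off_countable (n := 1) (E := ℝ)
    0 (fun _ => 2 * Real.pi) h0 F F' ∅ Set.countable_empty
    (continuous_iff_continuousAt.2 fun x => (hF x).continuousAt).continuousOn (fun x _ => hF x)
    (hcont.continuousOn.integrableOn_compact isCompact_Icc)]
  -- Opposite faces differ by the period in direction i, so their fluxes cancel.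
  refine Finset.sum_eq_zero fun i _ => sub_eq_zero.2 ?_
  refine integral_congr_ae (ae_of_all _ fun y => ?_)
  have h : (i.insertNth (2 * Real.pi) y : Plane) =
      i.insertNth (0 : ℝ) y + Pi.single i (2 * Real.pi) := by
    ext l
    refine Fin.succAboveCases i ?_ (fun m => ?_) l <;> simp
  simp only [Pi.zero_apply]
  rw [h, hper]

/-- Since div u = 0, the integrand is the divergence of the periodic field (v · w) u. -/
lemma IsTestField.integral_advection_antisymm {u v w : Plane → Vec} (hu : IsTestField u)
    (hv : IsTestField v) (hw : IsTestField w) :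
    ∫ x in cell, ((∑ j, inner ℝ (u x j • pderiv j v x) (w x)) +
      ∑ j, inner ℝ (u x j • pderiv j w x) (v x)) = 0 := by
  have du := hu.trig.differentiable
  have dv := hv.trig.differentiable
  have dw := hw.trig.differentiable
  have cu := du.continuous
  have cv := dv.continuous
  have cw := dw.continuous
  have cv' := hv.trig.continuous_pderiv
  have cw' := hw.trig.continuous_pderiv
  let F : Plane → Plane := fun x j => u x j * inner ℝ (v x) (w x)
  let F' : Plane → Plane →L[ℝ] Plane := fun x => ContinuousLinearMap.pi fun j =>
    u x j • ((innerSL ℝ (v x)).comp (fderiv ℝ w x) + (innerSL ℝ (w x)).comp (fderiv ℝ v x)) +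
      (inner ℝ (v x) (w x) : ℝ) • ((EuclideanSpace.proj (𝕜 := ℝ) j).comp (fderiv ℝ u x))
  have hF : ∀ x, HasFDerivAt F (F' x) x := by
    intro x
    refine hasFDerivAt_pi.2 fun j => ?_
    have h1 : HasFDerivAt (fun x => u x j)
        ((EuclideanSpace.proj (𝕜 := ℝ) j).comp (fderiv ℝ u x)) x :=
      (EuclideanSpace.proj (𝕜 := ℝ) j).hasFDerivAt.comp x (du x).hasFDerivAt
    have h2 := h1.mul ((dv x).hasFDerivAt.inner ℝ (dw x).hasFDerivAt)
    refine h2.congr_fderiv ?_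
    ext z
    simp [real_inner_comm, mul_add]
  have hdiv : ∀ x, ∑ i, F' x (Pi.single i 1) i =
      (∑ j, inner ℝ (u x j • pderiv j v x) (w x)) +
        ∑ j, inner ℝ (u x j • pderiv j w x) (v x) := by
    intro x
    have h1 : ∀ i, F' x (Pi.single i 1) i = inner ℝ (u x i • pderiv i v x) (w x) +
        inner ℝ (u x i • pderiv i w x) (v x) + inner ℝ (v x) (w x) * pderiv i u x i := by
      intro i
      simp only [F', ContinuousLinearMap.coe_pi', add_apply,
        smul_apply, ContinuousLinearMap.comp_apply,
        innerSL_apply_apply, smul_eq_mul, real_inner_smul_left]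
      rw [real_inner_comm (w x) (pderiv i v x), real_inner_comm (v x) (pderiv i w x)]
      change _ + _ * pderiv i u x i = _
      simp only [pderiv]
      ring
    simp only [h1, Finset.sum_add_distrib, ← Finset.mul_sum, hu.div_free, mul_zero, add_zero]
  have key := integral_divergence_eq_zero hF
    (fun i x => by
      simp only [F, hu.trig.periodic, hv.trig.periodic, hw.trig.periodic])
    (by simp only [hdiv]; fun_prop)
  simpa only [hdiv] using key

lemma V.IsTest.B_antisymm {u v w : V} (hu : u.IsTest) (hv : v.IsTest) (hw : w.IsTest) :
    B u v w = -B u w v := by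
  obtain ⟨u', hu', hu0, -⟩ := hu
  obtain ⟨v', hv', hv0, hv1⟩ := hv
  obtain ⟨w', hw', hw0, hw1⟩ := hw
  rw [← add_eq_zero_iff_eq_neg, B_eq_sum, B_eq_sum,
    ← integral_finsetSum _ fun j _ => integrable_advection _ _ _ j,
    ← integral_finsetSum _ fun j _ => integrable_advection _ _ _ j,
    ← integral_add (integrable_finsetSum _ fun j _ => integrable_advection _ _ _ j)
      (integrable_finsetSum _ fun j _ => integrable_advection _ _ _ j),
    ← hu'.integral_advection_antisymm hv' hw']
  refine integral_congr_ae ?_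
  filter_upwards [hu0, hv0, hw0, ae_all_iff.2 hv1, ae_all_iff.2 hw1] with x h1 h2 h3 h4 h5
  simp only [advection, h1, h2, h3, h4, h5]

/-- Both sides are continuous in all three arguments, and test fields are dense in V. -/
lemma B_antisymm (u v w : V) : B u v w = -B u w v := by
  obtain ⟨a, ha, hau⟩ := u.exists_seq_tendsto
  obtain ⟨b, hb, hbv⟩ := v.exists_seq_tendsto
  obtain ⟨c, hc, hcw⟩ := w.exists_seq_tendsto
  refine tendsto_nhds_unique (tendsto_B hau hbv hcw) ?_
  exact (tendsto_B hau hcw hbv).neg.congr fun n => ((ha n).B_antisymm (hb n) (hc n)).symm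

lemma B_self_right (u v : V) : B u v v = 0 := by
  linarith [B_antisymm u v v]

/-! ### Limits and algebra of A, B and B_s. -/

lemma tendsto_A {ι : Type*} {l : Filter ι} {a : ι → V} {u : V} (ha : Tendsto a l (𝓝 u)) (φ : V) :
    Tendsto (fun i => A (a i) φ) l (𝓝 (A u φ)) :=
  ha.inner tendsto_const_nhds

lemma tendsto_Bs {ι : Type*} {l : Filter ι} {b : ι → V} {v : V} (u : V)
    (hb : Tendsto b l (𝓝 v)) (φ : V) :
    Tendsto (fun i => Bs u (b i) φ) l (𝓝 (Bs u v φ)) :=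
  (tendsto_B tendsto_const_nhds hb tendsto_const_nhds).add
    (tendsto_B hb tendsto_const_nhds tendsto_const_nhds)

/-- Of the two terms, ⟨B(v,u),u⟩ vanishes and the other is turned around by antisymmetry. If
B(w₁,w₁) is a multiple of g, this converts ⟨B_s(w₁,w₂),w₁⟩ into a multiple of ⟨g,w₂⟩. -/
lemma Bs_apply_left (u v : V) : Bs u v u = -B u u v := by
  change B u v u + B v u u = _
  rw [B_self_right, add_zero, B_antisymm]

lemma Bs_apply_right (u v : V) : Bs u v v = -B v v u := by
  change B u v v + B v u v = _
  rw [B_self_right, zero_add, B_antisymm]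

lemma A_self (u : V) : A u u = ‖u‖ ^ 2 := real_inner_self_eq_norm_sq u

lemma A_smul (a : ℝ) (u φ : V) : A (a • u) φ = a * A u φ := real_inner_smul_left _ _ _

lemma A_add (u v φ : V) : A (u + v) φ = A u φ + A v φ := inner_add_left _ _ _

lemma A_zero : A 0 = 0 := funext fun φ => inner_zero_left φ

lemma B_zero_left (v : V) : B 0 v = 0 := funext fun φ => by
  simpa using B_smul_left 0 0 v φ

lemma B_smul_self (a : ℝ) (u φ : V) : B (a • u) (a • u) φ = a ^ 2 * B u u φ := by
  rw [B_smul_left, B_smul_middle]; ring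

lemma B_self_add_smul (a b : ℝ) (u v φ : V) : B (a • u + b • v) (a • u + b • v) φ =
    a ^ 2 * B u u φ + a * b * Bs u v φ + b ^ 2 * B v v φ := by
  change _ = _ + a * b * (B u v φ + B v u φ) + _
  simp only [B_add_left, B_add_middle, B_smul_left, B_smul_middle]; ring

/-! ### Comparison of sequences -/

lemma Dominates.tendsto_atTop {ξ : ℕ → ℝ} (h : ξ ≻ₛ 1) : Tendsto ξ atTop atTop := by
  simpa [Dominates] using h

lemma Comparable.exists_tendsto {ξ : ℕ → ℝ} (h : ξ ∼ₛ 1) :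
    ∃ l, 0 < l ∧ Tendsto ξ atTop (𝓝 l) := by
  simpa [Comparable] using h

lemma Dominates.tendsto_div {ξ η : ℕ → ℝ} (h : ξ ≻ₛ η) :
    Tendsto (fun n => η n / ξ n) atTop (𝓝 0) :=
  (tendsto_inv_atTop_zero.comp h).congr fun n => by simp

lemma Dominates.tendsto_zero {ξ : ℕ → ℝ} (h : 1 ≻ₛ ξ) : Tendsto ξ atTop (𝓝 0) := by
  simpa using h.tendsto_div

lemma eq_zero_of_tendsto_atTop {a p b : ℕ → ℝ} {a₀ b₀ c : ℝ} (ha : Tendsto a atTop (𝓝 a₀))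
    (hp : Tendsto p atTop atTop) (hb : Tendsto b atTop (𝓝 b₀)) (h : ∀ n, a n + p n * b n = c) :
    b₀ = 0 := by
  have h1 : Tendsto (fun n => (p n)⁻¹ * (c - a n)) atTop (𝓝 0) := by
    simpa using (tendsto_inv_atTop_zero.comp hp).mul (tendsto_const_nhds (x := c) |>.sub ha)
  refine tendsto_nhds_unique hb (h1.congr' ?_)
  filter_upwards [hp.eventually_gt_atTop 0] with n hn
  rw [← h n]
  field_simp
  ring

lemma mul_eq_of_tendsto {a p b : ℕ → ℝ} {l b₀ c : ℝ} (ha : Tendsto a atTop (𝓝 0))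
    (hp : Tendsto p atTop (𝓝 l)) (hb : Tendsto b atTop (𝓝 b₀)) (h : ∀ n, a n + p n * b n = c) :
    l * b₀ = c := by
  have h1 := ha.add (hp.mul hb)
  rw [zero_add] at h1
  exact tendsto_nhds_unique h1 (tendsto_const_nhds.congr fun n => (h n).symm)

/-- The positive and the negative case are merged by writing χ = ε|χ| with ε = ±1. -/
lemma SignedComparable.compare {S : Set (ℕ → ℝ)} {χ η : ℕ → ℝ} (h : SignedComparable S χ)
    (hη : η ∈ S) : (∀ n, χ n = 0) ∨
      (∃ ε : ℝ, ε ≠ 0 ∧ ∀ n, χ n = ε * |χ n|) ∧ (∀ n, 0 < |χ n|) ∧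
        (η ∼ₛ (fun n => |χ n|) ∨ η ≻ₛ (fun n => |χ n|) ∨ (fun n => |χ n|) ≻ₛ η) := by
  rcases h with h | ⟨h, hT⟩ | ⟨h, hT⟩
  · exact Or.inl h
  · have h1 : (fun n => |χ n|) = χ := funext fun n => abs_of_pos (h n)
    refine Or.inr ⟨⟨1, one_ne_zero, fun n => by rw [abs_of_pos (h n), one_mul]⟩,
      fun n => abs_pos.2 (h n).ne', ?_⟩
    rw [h1]
    exact hT η (Or.inl hη) χ (Or.inr rfl)
  · have h1 : (fun n => |χ n|) = -χ := funext fun n => abs_of_neg (h n)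
    refine Or.inr ⟨⟨-1, by norm_num, fun n => by rw [abs_of_neg (h n)]; ring⟩,
      fun n => abs_pos.2 (h n).ne, ?_⟩
    rw [h1]
    exact hT η (Or.inl hη) (-χ) (Or.inr rfl)

/-- If functionals `Lₙ` converge pointwise and `ηₙ Lₙ = χₙ γ` with `γ ≠ 0`, then the comparison of
`η` with `|χ|` determines the limit. -/
lemma balance {X : Type*} {γ : X → ℝ} (hγ : γ ≠ 0) {S : Set (ℕ → ℝ)} {χ η : ℕ → ℝ}
    (hη : η ∈ S) (hpos : ∀ n, 0 < η n) (hχ : SignedComparable S χ) {L : ℕ → X → ℝ} {L₀ : X → ℝ}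
    (hL : ∀ φ, Tendsto (fun n => L n φ) atTop (𝓝 (L₀ φ)))
    (heq : ∀ n φ, η n * L n φ = χ n * γ φ) :
    ((∀ n, χ n = 0) ∨ η ≿ₛ (fun n => |χ n|)) ∧
      (η ∼ₛ (fun n => |χ n|) → ∃ c : ℝ, c ≠ 0 ∧ L₀ = c • γ) ∧
      (((∀ n, χ n = 0) ∨ η ≻ₛ (fun n => |χ n|)) → L₀ = 0) := by
  have hL' : ∀ n φ, L n φ = χ n / η n * γ φ := fun n φ => by
    have := hpos n
    field_simp
    linarith [heq n φ]
  have hzero : (∀ n, χ n = 0) → L₀ = 0 := fun h => funext fun φ =>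
    tendsto_nhds_unique (hL φ) (tendsto_const_nhds.congr fun n => by simp [hL', h n])
  rcases hχ.compare hη with h0 | ⟨⟨ε, hε, hs⟩, habs, htri⟩
  -- For χ = 0 the comparison η ∼ |χ| is impossible: division by zero makes the quotient 0, whose
  -- limit is not positive.
  · refine ⟨Or.inl h0, fun ⟨l, hl, hlim⟩ => ?_, fun _ => hzero h0⟩
    simp only [h0, abs_zero, div_zero] at hlim
    exact absurd (tendsto_nhds_unique hlim tendsto_const_nhds) hl.ne'
  have hscale : ∀ {c : ℝ}, Tendsto (fun n => |χ n| / η n) atTop (𝓝 c) → L₀ = (ε * c) • γ := by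
    intro c hc
    funext φ
    refine tendsto_nhds_unique (hL φ) (((hc.const_mul ε).mul_const (γ φ)).congr fun n => ?_)
    rw [hL', ← mul_div_assoc, ← hs]
  refine ⟨Or.inr ?_, fun ⟨l, hl, hlim⟩ => ⟨ε * l⁻¹, mul_ne_zero hε (inv_ne_zero hl.ne'), ?_⟩, ?_⟩
  · rcases htri with h | h | h
    · exact Or.inr h
    · exact Or.inl h
    -- If |χ| dominated η, dividing the identity by |χ| would give εγ = 0 in the limit.
    · refine absurd (funext fun φ => ?_) hγ
      have h1 := h.tendsto_div.mul (hL φ)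
      rw [zero_mul] at h1
      have h2 : ε * γ φ = 0 := tendsto_nhds_unique (tendsto_const_nhds.congr fun n => by
        have := (habs n).ne'
        rw [div_mul_eq_mul_div, heq, eq_div_iff this]
        conv_rhs => rw [hs n]
        ring) h1
      exact (mul_eq_zero.1 h2).resolve_left hε
  · exact hscale ((hlim.inv₀ hl.ne').congr fun n => inv_div _ _)
  · rintro (h | h)
    · exact hzero h
    · simpa using hscale h.tendsto_div

/-! ### Expansions -/

lemma one_mem_indexSet {K : ℕ∞} (h : K ≠ 0) : 1 ∈ indexSet K :=
  ⟨le_rfl, by simpa using Order.one_le_iff_pos.2 (pos_iff_ne_zero.2 h)⟩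

lemma two_mem_indexSet {K : ℕ∞} (h0 : K ≠ 0) (h1 : K ≠ 1) : 2 ∈ indexSet K := by
  refine ⟨by norm_num, ?_⟩
  cases K with
  | top => exact le_top
  | coe k =>
    norm_cast at *
    omega

/-- In a unitary expansion, or a degenerate one with N ≥ 1, the first vector has norm one; only the
all-zero degenerate expansion remains. -/
lemma eq_zero_of_leading_eq_zero {Z : Type*} [NormedAddCommGroup Z] [NormedSpace ℝ Z]
    {x : ℕ → Z} {v : Z} {K : ℕ∞} {Γ : ℕ → ℕ → ℝ} {w : ℕ → Z}
    (hexp : IsUnitaryExpansion x v K Γ w ∨ IsDegenerateExpansion x v K Γ w)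
    (h1 : 1 ∈ indexSet K) (hw : w 1 = 0) : K = ⊤ ∧ ∀ k, 1 ≤ k → w k = 0 := by
  rcases hexp with h | ⟨-, hK, h | ⟨N, hN, h, -⟩⟩
  · simpa [hw] using h.2 1 h1
  · exact ⟨hK, h⟩
  · simpa [hw] using h 1 le_rfl hN

lemma IsRelaxedExpansion.isDegenerate_zero {Z : Type*} [NormedAddCommGroup Z] [NormedSpace ℝ Z]
    {x : ℕ → Z} {v : Z} {Γ : ℕ → ℕ → ℝ} {w : ℕ → Z} (h : IsRelaxedExpansion x v ⊤ Γ w)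
    (hw : ∀ k, 1 ≤ k → w k = 0) : IsDegenerateExpansion x v ⊤ Γ (fun _ => 0) := by
  have h0 : ∀ k ∈ indexSet ⊤, w k = 0 := fun k hk => hw k hk.1
  obtain ⟨r, hr1, hr2, hr3⟩ := h.remainder
  refine ⟨⟨h.trivial, h.pos, h.tendsto_one, h.tendsto_ratio, ⟨r, fun k hk => ?_, fun k hk n => ?_,
    fun k hk hK n => ?_⟩, fun k _ hK => absurd hK (ENat.natCast_ne_top k)⟩, rfl, Or.inl fun _ _ => rfl⟩
  · simpa only [h0 k hk] using hr1 k hk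
  · rw [hr2 k hk n]
    congr 2
    exact Finset.sum_congr rfl fun j hj => by rw [hw j (Finset.mem_Ico.1 hj).1]
  · rw [hr3 k hk hK n, h0 k hk]

lemma toDual_apply (g : L2) (u : V) : toDual g u = inner ℝ g u.field := rfl

/-- Here A u is a multiple of B(u,u), and testing with u leaves ‖u‖² = 0. -/
lemma eq_zero_of_A_eq_smul {γ : V → ℝ} {u : V} {μ c : ℝ} (hγ : μ • B u u = γ)
    (h : A u = c • γ) : u = 0 := by
  have h1 := congrFun h u
  rw [A_self, ← hγ, Pi.smul_apply, Pi.smul_apply, B_self_right, smul_zero, smul_zero] at h1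
  simpa using h1

/-! ### The steady equation along an expansion at zero -/

section Steady

variable {γ : V → ℝ} {α : ℕ → ℝ} {x : ℕ → V}

lemma steady_one_term (h : ∀ n, A (x n) + α n • B (x n) (x n) = γ) {a : ℕ → ℝ} {r : ℕ → V}
    (hx : ∀ n, x n = a n • r n) (n : ℕ) (φ : V) :
    a n * A (r n) φ + α n * a n ^ 2 * B (r n) (r n) φ = γ φ := by
  have h1 := congrFun (h n) φ
  rw [Pi.add_apply, Pi.smul_apply, hx, A_smul, B_smul_self, smul_eq_mul] at h1
  linarith

/-- The term αb²B(r,r) is put under the weight αab, where its relative coefficient b/a will tend to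
zero. -/
lemma steady_two_terms (h : ∀ n, A (x n) + α n • B (x n) (x n) = γ) {a b : ℕ → ℝ} {u : V}
    {r : ℕ → V} (ha : ∀ n, 0 < a n) (hx : ∀ n, x n = a n • u + b n • r n) (n : ℕ) (φ : V) :
    a n * A u φ + b n * A (r n) φ + α n * a n ^ 2 * B u u φ +
      α n * a n * b n * (Bs u (r n) φ + b n / a n * B (r n) (r n) φ) = γ φ := by
  have h1 := congrFun (h n) φ
  rw [Pi.add_apply, Pi.smul_apply, hx, A_add, A_smul, A_smul, B_self_add_smul, smul_eq_mul] at h1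
  have h2 : α n * a n * b n * (b n / a n) = α n * b n ^ 2 := by
    have := (ha n).ne'
    field_simp
  linear_combination h1 + B (r n) (r n) φ * h2

/-- The leading balance: the limit of `αₙ aₙ²` determines `B(u, u)`. -/
lemma steady_leading (h : ∀ n, A (x n) + α n • B (x n) (x n) = γ) {a : ℕ → ℝ} {r : ℕ → V} {u : V}
    (hx : ∀ n, x n = a n • r n) (ha : Tendsto a atTop (𝓝 0)) (hr : Tendsto r atTop (𝓝 u)) :
    (∀ l, Tendsto (fun n => α n * a n ^ 2) atTop (𝓝 l) → l • B u u = γ) ∧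
      (Tendsto (fun n => α n * a n ^ 2) atTop atTop → B u u = 0) := by
  have h1 := steady_one_term h hx
  have h2 : ∀ φ, Tendsto (fun n => a n * A (r n) φ) atTop (𝓝 0) := fun φ => by
    simpa using ha.mul (tendsto_A hr φ)
  have h3 : ∀ φ, Tendsto (fun n => B (r n) (r n) φ) atTop (𝓝 (B u u φ)) := fun φ =>
    tendsto_B hr hr tendsto_const_nhds
  exact ⟨fun l hl => funext fun φ => mul_eq_of_tendsto (h2 φ) hl (h3 φ) fun n => h1 n φ,
    fun hl => funext fun φ => eq_zero_of_tendsto_atTop (h2 φ) hl (h3 φ) fun n => h1 n φ⟩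

/-- No solution sequence is of the form `aₙ u` with a fixed `u ≠ 0` and `aₙ → 0`. -/
lemma steady_single_eq_zero (h : ∀ n, A (x n) + α n • B (x n) (x n) = γ) (hγ : γ ≠ 0) {a : ℕ → ℝ}
    {u : V} (hx : ∀ n, x n = a n • u) (ha0 : ∀ n, 0 < a n) (ha : Tendsto a atTop (𝓝 0))
    (hcmp : (fun n => α n * a n ^ 2) ≿ₛ 1) : u = 0 := by
  have hl := steady_leading h hx ha tendsto_const_nhds
  -- If αa² → ∞, then B(u,u) = 0 and γ = aₙ A u → 0. Otherwise γ is a multiple of B(u,u), and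
  -- testing the equation at n = 0 with u leaves a₀‖u‖² = 0.
  rcases hcmp with hc | hc
  · refine absurd (funext fun φ => ?_) hγ
    have h1 : ∀ n, γ φ = a n * A u φ := fun n => by
      rw [← steady_one_term h hx n φ, hl.2 hc.tendsto_atTop]; simp
    have h2 := ha.mul_const (A u φ)
    rw [zero_mul] at h2
    exact tendsto_nhds_unique (tendsto_const_nhds.congr h1) h2
  · obtain ⟨l, -, hlim⟩ := hc.exists_tendsto
    have h1 := steady_one_term h hx 0 u
    rw [← hl.1 l hlim, Pi.smul_apply, B_self_right, A_self] at h1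
    simpa [(ha0 0).ne'] using h1

variable {a b : ℕ → ℝ} {u v : V} {r : ℕ → V}

lemma tendsto_quadratic (hba : Tendsto (fun n => b n / a n) atTop (𝓝 0))
    (hr : Tendsto r atTop (𝓝 v)) (φ : V) :
    Tendsto (fun n => Bs u (r n) φ + b n / a n * B (r n) (r n) φ) atTop (𝓝 (Bs u v φ)) := by
  simpa using (tendsto_Bs u hr φ).add (hba.mul (tendsto_B hr hr tendsto_const_nhds))

/-- The second balance if the leading quadratic term vanishes. -/
lemma steady_second (h : ∀ n, A (x n) + α n • B (x n) (x n) = γ) (ha0 : ∀ n, 0 < a n)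
    (hx : ∀ n, x n = a n • u + b n • r n) (ha : Tendsto a atTop (𝓝 0)) (hb : Tendsto b atTop (𝓝 0))
    (hba : Tendsto (fun n => b n / a n) atTop (𝓝 0)) (hr : Tendsto r atTop (𝓝 v))
    (huu : B u u = 0) :
    (∀ l, Tendsto (fun n => α n * a n * b n) atTop (𝓝 l) → l • Bs u v = γ) ∧
      (Tendsto (fun n => α n * a n * b n) atTop atTop → Bs u v = 0) := by
  have h1 : ∀ n φ, (a n * A u φ + b n * A (r n) φ) +
      α n * a n * b n * (Bs u (r n) φ + b n / a n * B (r n) (r n) φ) = γ φ := fun n φ => by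
    rw [← steady_two_terms h ha0 hx n φ, huu]; simp
  have h2 : ∀ φ, Tendsto (fun n => a n * A u φ + b n * A (r n) φ) atTop (𝓝 0) := fun φ => by
    simpa using (ha.mul_const (A u φ)).add (hb.mul (tendsto_A hr φ))
  have h3 := fun φ => tendsto_quadratic (u := u) hba hr φ
  exact ⟨fun l hl => funext fun φ => mul_eq_of_tendsto (h2 φ) hl (h3 φ) fun n => h1 n φ,
    fun hl => funext fun φ => eq_zero_of_tendsto_atTop (h2 φ) hl (h3 φ) fun n => h1 n φ⟩

/-- The leading quadratic term is αa²B(u,u) = (1 - χ)γ; moving it to the right leaves χγ. -/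
lemma steady_defect (h : ∀ n, A (x n) + α n • B (x n) (x n) = γ) (ha0 : ∀ n, 0 < a n)
    (hx : ∀ n, x n = a n • u + b n • r n) {μ : ℝ} (hμ : μ ≠ 0) (huu : μ • B u u = γ) {χ : ℕ → ℝ}
    (hχ : ∀ n, χ n = 1 - α n * a n ^ 2 / μ) (n : ℕ) (φ : V) :
    a n * A u φ + b n * A (r n) φ +
      α n * a n * b n * (Bs u (r n) φ + b n / a n * B (r n) (r n) φ) = χ n * γ φ := by
  have h1 := steady_two_terms h ha0 hx n φ
  have h2 : γ φ = μ * B u u φ := by rw [← huu]; rfl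
  have h3 : χ n * γ φ = γ φ - α n * a n ^ 2 * B u u φ := by
    rw [hχ, h2]; field_simp
  linarith

end Steady

end PeriodicNSE

/-! ### The theorem: comparison of orders case by case. -/

theorem theorem4p6
    (g : L2) (hgH : g ∈ H) (hg0 : g ≠ 0)
    (α : ℕ → ℝ) (hα : ∀ n, 0 < α n) (hα_lim : Tendsto α atTop atTop)
    (x : ℕ → V) (hsteady : ∀ n, A (x n) + α n • B (x n) (x n) = toDual g)
    (K : ℕ∞) (Γ : ℕ → ℕ → ℝ) (w : ℕ → V)
    (hexp : IsUnitaryExpansion x 0 K Γ w ∨ IsDegenerateExpansion x 0 K Γ w)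
    (hS : TotallyComparable (coeffSet α K Γ)) :
    ((fun n => α n * Γ 1 n ^ 2) ≿ₛ 1) ∧ 2 ∈ indexSet K ∧
    -- (i)
    (((fun n => α n * Γ 1 n ^ 2) ≻ₛ 1) →
      B (w 1) (w 1) = 0 ∧
      ((fun n => α n * Γ 1 n * Γ 2 n) ≿ₛ 1) ∧
      (((fun n => α n * Γ 1 n * Γ 2 n) ≻ₛ 1) → Bs (w 1) (w 2) = 0) ∧
      (((fun n => α n * Γ 1 n * Γ 2 n) ∼ₛ 1) →
        (∃ μ : ℝ, 0 < μ ∧ μ • Bs (w 1) (w 2) = toDual g) ∧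
        inner ℝ g (w 1).field = 0)) ∧
    -- (ii)
    (((fun n => α n * Γ 1 n ^ 2) ∼ₛ 1) →
      ∀ μs : ℝ, Tendsto (fun n => α n * Γ 1 n ^ 2) atTop (𝓝 μs) →
        μs • B (w 1) (w 1) = toDual g ∧
        ∀ χ : ℕ → ℝ, (∀ n, χ n = 1 - α n * Γ 1 n ^ 2 / μs) →
          SignedComparable (coeffSet α K Γ) χ →
          -- (ii) (1)
          ((1 ≻ₛ (fun n => α n * Γ 2 n)) →
            ((∀ n, χ n = 0) ∨ Γ 1 ≻ₛ (fun n => |χ n|)) ∧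
            K = ⊤ ∧ (∀ k, 1 ≤ k → w k = 0) ∧
            IsDegenerateExpansion x 0 ⊤ Γ (fun _ => 0)) ∧
          -- (ii) (2)
          (((fun n => α n * Γ 2 n) ∼ₛ 1) →
            ((∀ n, χ n = 0) ∨ Γ 1 ≿ₛ (fun n => |χ n|)) ∧
            (Γ 1 ∼ₛ (fun n => |χ n|) →
              ∃ μ₁ μ₂ : ℝ, 0 < μ₁ * μ₂ ∧
                μ₁ • A (w 1) + μ₂ • Bs (w 1) (w 2) = toDual g ∧
                μs * μ₁ * ‖w 1‖ ^ 2 = μ₂ * inner ℝ g (w 2).field) ∧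
            (((∀ n, χ n = 0) ∨ Γ 1 ≻ₛ (fun n => |χ n|)) →
              ∃ μ₂ : ℝ, 0 < μ₂ ∧
                A (w 1) + μ₂ • Bs (w 1) (w 2) = 0 ∧
                μs * ‖w 1‖ ^ 2 = μ₂ * inner ℝ g (w 2).field)) ∧
          -- (ii) (3)
          (((fun n => α n * Γ 2 n) ≻ₛ 1) →
            ((∀ n, χ n = 0) ∨ (fun n => α n * Γ 1 n * Γ 2 n) ≿ₛ (fun n => |χ n|)) ∧
            (((fun n => α n * Γ 1 n * Γ 2 n) ∼ₛ (fun n => |χ n|)) →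
              (∃ μ₂ : ℝ, μ₂ ≠ 0 ∧ μ₂ • Bs (w 1) (w 2) = toDual g) ∧
              inner ℝ g (w 2).field = 0 ∧ B (w 2) (w 2) (w 1) = 0) ∧
            (((∀ n, χ n = 0) ∨ (fun n => α n * Γ 1 n * Γ 2 n) ≻ₛ (fun n => |χ n|)) →
              Bs (w 1) (w 2) = 0 ∧
              inner ℝ g (w 2).field = 0 ∧ B (w 2) (w 2) (w 1) = 0))) := by
  have hγ : toDual g ≠ 0 := fun h => hg0 (eq_zero_of_toDual_eq_zero hgH h)
  have hrel : IsRelaxedExpansion x 0 K Γ w := hexp.elim And.left And.left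
  have hK0 : K ≠ 0 := by
    intro h
    refine hγ ?_
    rw [← hsteady 0, hrel.trivial h 0]
    rw [A_zero, B_zero_left, smul_zero, add_zero]
  have h1 := one_mem_indexSet hK0
  obtain ⟨r, hr, hxr, hlast⟩ := hrel.remainder
  have hp1 := hrel.pos 1 h1
  have ht1 := hrel.tendsto_one h1
  have hx1 : ∀ n, x n = Γ 1 n • r 1 n := fun n => by simpa using hxr 1 h1 n
  have hlead := steady_leading hsteady hx1 ht1 (hr 1 h1)
  have hone : (1 : ℕ → ℝ) ∈ coeffSet α K Γ := Or.inl (Or.inl (Or.inr rfl))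
  have hsq : (fun n => α n * Γ 1 n ^ 2) ∈ coeffSet α K Γ :=
    Or.inr ⟨1, h1, 1, h1, le_rfl, funext fun n => by ring⟩
  have hfirst : (fun n => α n * Γ 1 n ^ 2) ≿ₛ 1 := by
    rcases hS _ hsq _ hone with h | h | h
    · exact Or.inr h
    · exact Or.inl h
    · exact absurd (by simpa using (hlead.1 0 h.tendsto_zero).symm) hγ
  -- A one-term expansion has remainder exactly `w 1`, so x would be a multiple of a fixed nonzero
  -- vector.
  have h2 : 2 ∈ indexSet K := by
    refine two_mem_indexSet hK0 fun hK1 => ?_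
    have hK1' : ((1 : ℕ) : ℕ∞) = K := by simp [hK1]
    exact hrel.last_ne_zero 1 h1 hK1' (steady_single_eq_zero hsteady hγ
      (fun n => by rw [hx1, hlast 1 h1 hK1' n]) hp1 ht1 hfirst)
  have hp2 := hrel.pos 2 h2
  have hba : Tendsto (fun n => Γ 2 n / Γ 1 n) atTop (𝓝 0) := hrel.tendsto_ratio 1 h1 h2
  have ht2 : Tendsto (Γ 2) atTop (𝓝 0) := by
    have h := hba.mul ht1
    rw [zero_mul] at h
    exact h.congr fun n => div_mul_cancel₀ _ (hp1 n).ne'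
  have hx2 : ∀ n, x n = Γ 1 n • w 1 + Γ 2 n • r 2 n := fun n => by simpa using hxr 2 h2 n
  have hr2 := hr 2 h2
  have hprod : (fun n => α n * Γ 1 n * Γ 2 n) ∈ coeffSet α K Γ :=
    Or.inr ⟨1, h1, 2, h2, by norm_num, rfl⟩
  have hΓ1 : Γ 1 ∈ coeffSet α K Γ := Or.inl (Or.inr ⟨1, h1, Or.inl rfl⟩)
  refine ⟨hfirst, h2, fun hdom => ?_, fun _ μs hμs => ?_⟩
  · have huu := hlead.2 hdom.tendsto_atTop
    have hsec := steady_second hsteady hp1 hx2 ht1 ht2 hba hr2 huu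
    refine ⟨huu, ?_, fun h => hsec.2 h.tendsto_atTop, fun h => ?_⟩
    · rcases hS _ hprod _ hone with h | h | h
      · exact Or.inr h
      · exact Or.inl h
      · exact absurd (by simpa using (hsec.1 0 h.tendsto_zero).symm) hγ
    · obtain ⟨l, hl, hlim⟩ := h.exists_tendsto
      have hBs := hsec.1 l hlim
      refine ⟨⟨l, hl, hBs⟩, ?_⟩
      rw [← toDual_apply, ← hBs, Pi.smul_apply, Bs_apply_left, huu]
      simp
  have huu := hlead.1 μs hμs
  have hμ0 : μs ≠ 0 := by
    rintro rfl
    exact hγ (by simpa using huu.symm)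
  have hg1 : toDual g (w 1) = 0 := by
    rw [← huu, Pi.smul_apply, B_self_right, smul_zero]
  have hg2 : toDual g (w 2) = -(μs * Bs (w 1) (w 2) (w 1)) := by
    rw [← huu, Bs_apply_left, Pi.smul_apply, smul_eq_mul]; ring
  refine ⟨huu, fun χ hχ hsc => ?_⟩
  have hdef := steady_defect hsteady hp1 hx2 hμ0 huu hχ
  have hquad := tendsto_quadratic (u := w 1) hba hr2
  have hlin : ∀ φ, Tendsto (fun n => A (w 1) φ + Γ 2 n / Γ 1 n * A (r 2 n) φ) atTop
      (𝓝 (A (w 1) φ)) := fun φ => by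
    simpa using (hba.mul (tendsto_A hr2 φ)).const_add (A (w 1) φ)
  -- The defect identity divided by Γ₁, for αΓ₂ → l; the case l = 0 keeps only A w₁ in the limit.
  have hbal1 : ∀ l, Tendsto (fun n => α n * Γ 2 n) atTop (𝓝 l) → _ := fun l hl =>
    balance hγ hΓ1 hp1 hsc (L₀ := A (w 1) + l • Bs (w 1) (w 2))
      (L := fun n φ => (A (w 1) φ + Γ 2 n / Γ 1 n * A (r 2 n) φ) +
        α n * Γ 2 n * (Bs (w 1) (r 2 n) φ + Γ 2 n / Γ 1 n * B (r 2 n) (r 2 n) φ))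
      (fun φ => (hlin φ).add (hl.mul (hquad φ)))
      (fun n φ => by
        rw [← hdef]
        have := (hp1 n).ne'
        field_simp)
  refine ⟨fun hdom => ?_, fun hcmp => ?_, fun hdom => ?_⟩
  · obtain ⟨hb, hb1, hb2⟩ := hbal1 0 hdom.tendsto_zero
    rw [zero_smul, add_zero] at hb1 hb2
    have hcase : (∀ n, χ n = 0) ∨ Γ 1 ≻ₛ (fun n => |χ n|) := by
      rcases hb with h | h | h
      · exact Or.inl h
      · exact Or.inr h
      · obtain ⟨c, -, hc⟩ := hb1 h
        have hw : w 1 = 0 := eq_zero_of_A_eq_smul huu hc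
        refine absurd ?_ hγ
        rw [← huu, hw, B_zero_left, smul_zero]
    -- The limit equation is now A w₁ = 0. Since μ_* B(w₁,w₁) = g ≠ 0 also forbids w₁ = 0, this case
    -- is in fact contradictory.
    have hw : w 1 = 0 := eq_zero_of_A_eq_smul (c := 0) huu (by rw [hb2 hcase, zero_smul])
    obtain ⟨rfl, hall⟩ := eq_zero_of_leading_eq_zero hexp h1 hw
    exact ⟨hcase, rfl, hall, hrel.isDegenerate_zero hall⟩
  · obtain ⟨l, hl, hlim⟩ := hcmp.exists_tendsto
    obtain ⟨hb, hb1, hb2⟩ := hbal1 l hlim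
    refine ⟨hb, fun h => ?_, fun h => ?_⟩
    · obtain ⟨c, hc, hL⟩ := hb1 h
      -- The limit equation A w₁ + l B_s(w₁,w₂) = c g is divided by c, whose sign is unknown; the
      -- product of the coefficients is l/c² > 0.
      refine ⟨c⁻¹, c⁻¹ * l, ?_, ?_, ?_⟩
      · have : 0 < c⁻¹ ^ 2 := by positivity
        nlinarith
      · rw [mul_smul, ← smul_add, hL, inv_smul_smul₀ hc]
      · have hw := congrFun hL (w 1)
        simp only [Pi.add_apply, Pi.smul_apply, smul_eq_mul, A_self, hg1] at hw
        rw [← toDual_apply, hg2]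
        linear_combination μs * c⁻¹ * hw
    · have hL := hb2 h
      refine ⟨l, hl, hL, ?_⟩
      have hw := congrFun hL (w 1)
      simp only [Pi.add_apply, Pi.smul_apply, smul_eq_mul, A_self, Pi.zero_apply] at hw
      rw [← toDual_apply, hg2]
      linear_combination μs * hw
  · have hinv : Tendsto (fun n => (α n * Γ 2 n)⁻¹) atTop (𝓝 0) :=
      tendsto_inv_atTop_zero.comp hdom.tendsto_atTop
    -- Now αΓ₁Γ₂ is the larger order: after division by it the linear part carries the factor
    -- 1/(αΓ₂) → 0.
    obtain ⟨hb, hb1, hb2⟩ := balance hγ hprod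
      (fun n => mul_pos (mul_pos (hα n) (hp1 n)) (hp2 n)) hsc (L₀ := Bs (w 1) (w 2))
      (L := fun n φ => (α n * Γ 2 n)⁻¹ * (A (w 1) φ + Γ 2 n / Γ 1 n * A (r 2 n) φ) +
        (Bs (w 1) (r 2 n) φ + Γ 2 n / Γ 1 n * B (r 2 n) (r 2 n) φ))
      (fun φ => by simpa using (hinv.mul (hlin φ)).add (hquad φ))
      (fun n φ => by
        rw [← hdef]
        have := (hp1 n).ne'
        have := (hp2 n).ne'
        have := (hα n).ne'
        field_simp)
    -- Testing with w₁, where ⟨g,w₁⟩ = 0, gives ⟨g,w₂⟩ = 0; testing with w₂ then gives ⟨B(w₂,w₂),w₁⟩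
    -- = 0. Allowing c = 0 covers both subcases.
    have hend : ∀ c : ℝ, Bs (w 1) (w 2) = c • toDual g →
        inner ℝ g (w 2).field = 0 ∧ B (w 2) (w 2) (w 1) = 0 := by
      intro c hc
      have hz : toDual g (w 2) = 0 := by
        rw [hg2, hc, Pi.smul_apply, hg1]; simp
      refine ⟨hz, ?_⟩
      have h := Bs_apply_right (w 1) (w 2)
      rw [hc, Pi.smul_apply, hz, smul_zero] at h
      linarith
    refine ⟨hb, fun h => ?_, fun h => ?_⟩
    · obtain ⟨c, hc, hL⟩ := hb1 h
      exact ⟨⟨c⁻¹, inv_ne_zero hc, by rw [hL, inv_smul_smul₀ hc]⟩, hend c hL⟩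
    · have hL := hb2 h
      exact ⟨hL, hend 0 (by rw [hL, zero_smul])⟩
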